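/- **Theorem 4.1.** Let $\beta\in(0,\infty]$, $1\le p<\infty$, $c\ge 0$, $\varepsilon>0$. Let $k^\mp:\mathbf R\to\mathbf R$ be measurable functions with $\int_{\mathbf R}|k^\mp(x)|^2e^{\varepsilon|x|}\,dx<\infty$ such that $k^+$ vanishes a.e. on $(-\infty,0)$ and $k^-$ vanishes a.e. on $(0,\infty)$, and put $\widehat{k^\mp}(z)=\int_{\mathbf R}e^{izy}k^\mp(y)\,dy$. Let $X^\mp$ be the space of complex-valued functions $L^p\big((0,\beta),e^{\pm ct}dt\big)$ (a Hilbert space for $p=2$, and $X^\mp=L^p(0,\beta)$ for $c=0$). In $X^\mp$ consider the operators $$(\mathcal J^+g)(t)=\int_0^t g(\tau)\,d\tau,\qquad (\mathcal J^-g)(t)=\int_t^\beta g(\tau)\,d\tau=\lim_{b\uparrow\beta}\int_t^b g(\tau)\,d\tau ,$$ whose domains consist of those $g\in X^\mp$ for which the integral exists for a.e. $t \in (0,\beta)$ and defines an element of $X^\mp$. The operators $\widehat{k^\mp}(\mp i/\mathcal J^\mp)$ are defined as follows. For $\delta>0$ the operator $\mathcal J^\mp+\delta I$ has a bounded everywhere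 defined inverse on $X^\mp$, and the spectrum of the bounded operator $T_\delta^\mp=\mp i\,(\mathcal J^\mp+\delta I)^{-1}$ lies inside a circle $\Gamma_\delta$ which, together with its interior, is contained in the half plane $\{\mp\operatorname{Im}z>-\varepsilon/2\}$, on which $\widehat{k^\mp}$ is holomorphic; one puts $$\widehat{k^\mp}(T_\delta^\mp)=\frac1{2\pi i}\oint_{\Gamma_\delta}\widehat{k^\mp}(z)\,(z-T_\delta^\mp)^{-1}dz ,\qquad \widehat{k^\mp}(\mp i/\mathcal J^\mp)\,g=\lim_{\delta\to0^+}\widehat{k^\mp}(T_\delta^\mp)\,g\quad\text{in }X^\mp .$$ Then all this is well defined, that is, the inverses and the circles $\Gamma_\delta$ exist, $\widehat{k^\mp}$ is holomorphic on the half plane, the limits exist for all $g\in X^\mp$ and $\widehat{k^\mp}(\mp i/\mathcal J^\mp)$ is a bounded operator on $X^\mp$. Moreover, for every $g\in X^+$ (respectively $g\in X^-$) and almost every $t\in(0,\beta)$ the integral $$q^+(t)=\int_0^t k^+(t-y)\,g(y)\,dy\qquad\Big(\text{respectively } q^-(t)=\int_t^\beta k^-(t-y)\,g(y)\,dy\Big)$$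 converges absolutely, and $$q^\mp=\widehat{k^\mp}\big(\mp i/\mathcal J^\mp\big)\,g\qquad\text{a.e. on }(0,\beta).$$ -/

import Mathlib

open MeasureTheory Filter Topology Set

noncomputable section

namespace IndefConv

/-! ### The function spaces -/

/-- The interval `(0, β)`, where `β` may be `+∞`. -/
def interval (β : EReal) : Set ℝ := {t : ℝ | 0 < t ∧ (t : EReal) < β}

/-- The measure `e^{κ t} dt` on `(0, β)`. -/
def expMeasure (β : EReal) (κ : ℝ) : Measure ℝ :=
  (volume.restrict (interval β)).withDensity (fun t => ENNReal.ofReal (Real.exp (κ * t)))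

/-- The complex space `L^p((0, β), e^{κ t} dt)`; it is `L^p(0, β)` for `κ = 0`,
and a Hilbert space for `p = 2`. -/
abbrev Space (p : ENNReal) (β : EReal) (κ : ℝ) : Type := Lp ℂ p (expMeasure β κ)

/-- `k` belongs to `𝓛_ε`: it is real valued, measurable, and `∫ |k x|² e^{ε |x|} dx < ∞`. -/
def MemWeighted (ε : ℝ) (k : ℝ → ℝ) : Prop :=
  AEStronglyMeasurable k volume ∧ Integrable (fun x => (k x) ^ 2 * Real.exp (ε * |x|)) volume

/-- `𝓛_ε⁺`: the members of `𝓛_ε` that vanish on `(-∞, 0)`. -/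
def MemWeightedPlus (ε : ℝ) (k : ℝ → ℝ) : Prop :=
  MemWeighted ε k ∧ ∀ᵐ x : ℝ, x < 0 → k x = 0

/-- `𝓛_ε⁻`: the members of `𝓛_ε` that vanish on `(0, ∞)`. -/
def MemWeightedMinus (ε : ℝ) (k : ℝ → ℝ) : Prop :=
  MemWeighted ε k ∧ ∀ᵐ x : ℝ, 0 < x → k x = 0

/-- The Fourier transform `∫ e^{i z y} k(y) dy`, at a complex argument `z`. -/
def hat (k : ℝ → ℝ) (z : ℂ) : ℂ :=
  ∫ y : ℝ, Complex.exp (Complex.I * z * (y : ℂ)) * (k y : ℂ)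

/-! ### The indefinite integration operators -/

/-- `f(t) = ∫_0^t g(τ) dτ` for almost all `t ∈ (0, β)`, these integrals being defined. -/
def HasJPlus (β : EReal) (g f : ℝ → ℂ) : Prop :=
  ∀ᵐ t : ℝ, t ∈ interval β →
    IntervalIntegrable g volume 0 t ∧ f t = ∫ τ in (0 : ℝ)..t, g τ

/-- `f(t) = ∫_t^β g(τ) dτ` for almost all `t ∈ (0, β)`, the integral being the limit of
`∫_t^b g(τ) dτ` as `b` increases to `β`. (This is the Lebesgue integral as soon as `g` is integrable
on `(t, β)`.) -/
def HasJMinus (β : EReal) (g f : ℝ → ℂ) : Prop :=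
  ∀ᵐ t : ℝ, t ∈ interval β →
    (∀ b : ℝ, t < b → (b : EReal) < β → IntervalIntegrable g volume t b) ∧
      Tendsto (fun b : ℝ => ∫ τ in t..b, g τ)
        (comap (fun b : ℝ => (b : EReal)) (𝓝[<] β)) (𝓝 (f t))

theorem measurableSet_interval (β : EReal) : MeasurableSet (interval β) :=
  measurableSet_Ioi.inter (measurable_coe_real_ereal measurableSet_Iio)

theorem ae_expMeasure_iff {β : EReal} {κ : ℝ} {P : ℝ → Prop} :
    (∀ᵐ t ∂(expMeasure β κ), P t) ↔ ∀ᵐ t : ℝ, t ∈ interval β → P t := by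
  unfold expMeasure
  rw [ae_withDensity_iff (by fun_prop), ae_restrict_iff' (measurableSet_interval β)]
  have h : ∀ t : ℝ, ENNReal.ofReal (Real.exp (κ * t)) ≠ 0 := fun t => by
    simp [Real.exp_pos]
  simp [h]

theorem comap_le_Ioo {β : EReal} {t : ℝ} (ht : (t : EReal) < β) :
    ∀ᶠ b : ℝ in comap (fun b : ℝ => (b : EReal)) (𝓝[<] β), t < b ∧ (b : EReal) < β := by
  have h : ∀ᶠ x : EReal in 𝓝[<] β, (t : EReal) < x ∧ x < β := Ioo_mem_nhdsLT ht
  filter_upwards [h.comap (fun b : ℝ => (b : EReal))] with b hb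
  exact ⟨by exact_mod_cast hb.1, hb.2⟩

theorem comap_neBot {β : EReal} {t : ℝ} (ht : (t : EReal) < β) :
    (comap (fun b : ℝ => (b : EReal)) (𝓝[<] β)).NeBot := by
  rw [comap_neBot_iff]
  intro s hs
  obtain ⟨u, hu, hus⟩ := (mem_nhdsLT_iff_exists_Ioo_subset' ht).1 hs
  obtain ⟨x, hx1, hx2⟩ := EReal.lt_iff_exists_real_btwn.1 (show u < β from hu)
  exact ⟨x, hus ⟨hx1, hx2⟩⟩

theorem HasJPlus.congr {β : EReal} {g g' f f' : ℝ → ℂ} (h : HasJPlus β g f)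
    (hg : ∀ᵐ t : ℝ, t ∈ interval β → g' t = g t)
    (hf : ∀ᵐ t : ℝ, t ∈ interval β → f' t = f t) : HasJPlus β g' f' := by
  filter_upwards [h, hf] with t ht hft htI
  have hsub : ∀ x ∈ Set.uIoc 0 t, x ∈ interval β := fun x hx => by
    rw [Set.uIoc_of_le htI.1.le] at hx
    exact ⟨hx.1, lt_of_le_of_lt (by exact_mod_cast hx.2) htI.2⟩
  have hae : ∀ᵐ x : ℝ, x ∈ Set.uIoc 0 t → g' x = g x := by
    filter_upwards [hg] with x hx hxt using hx (hsub x hxt)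
  refine ⟨(ht htI).1.congr_ae ?_, ?_⟩
  · rw [Filter.EventuallyEq, ae_restrict_iff' measurableSet_uIoc]
    filter_upwards [hae] with x hx hxt using (hx hxt).symm
  · rw [hft htI, (ht htI).2]
    exact (intervalIntegral.integral_congr_ae hae).symm

theorem HasJMinus.congr {β : EReal} {g g' f f' : ℝ → ℂ} (h : HasJMinus β g f)
    (hg : ∀ᵐ t : ℝ, t ∈ interval β → g' t = g t)
    (hf : ∀ᵐ t : ℝ, t ∈ interval β → f' t = f t) : HasJMinus β g' f' := by
  filter_upwards [h, hf] with t ht hft htI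
  have hae : ∀ b : ℝ, t < b → (b : EReal) < β →
      ∀ᵐ x : ℝ, x ∈ Set.uIoc t b → g' x = g x := by
    intro b htb hb
    filter_upwards [hg] with x hx hxt
    rw [Set.uIoc_of_le htb.le] at hxt
    exact hx ⟨htI.1.trans hxt.1, lt_of_le_of_lt (by exact_mod_cast hxt.2) hb⟩
  refine ⟨fun b htb hb => ((ht htI).1 b htb hb).congr_ae ?_, ?_⟩
  · rw [Filter.EventuallyEq, ae_restrict_iff' measurableSet_uIoc]
    filter_upwards [hae b htb hb] with x hx hxt using (hx hxt).symm
  · rw [hft htI]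
    refine (ht htI).2.congr' ?_
    filter_upwards [comap_le_Ioo htI.2] with b hb
    exact (intervalIntegral.integral_congr_ae (hae b hb.1 hb.2)).symm

/-- The graph of `𝓙⁺` in `L^p((0, β), e^{κ t} dt)`: the pairs `(g, f)` with `f = ∫_0^t g`. -/
def JPlusGraph (p : ENNReal) [Fact (1 ≤ p)] (β : EReal) (κ : ℝ) :
    Submodule ℂ (Space p β κ × Space p β κ) where
  carrier := {x | HasJPlus β x.1 x.2}
  zero_mem' := by
    have h0 : HasJPlus β (fun _ => 0) (fun _ => 0) := by
      filter_upwards with t ht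
      simp
    refine h0.congr ?_ ?_ <;>
    · rw [← ae_expMeasure_iff (κ := κ)]
      exact Lp.coeFn_zero ℂ p (expMeasure β κ)
  add_mem' := by
    intro x y hx hy
    have h0 : HasJPlus β (fun t => x.1 t + y.1 t) (fun t => x.2 t + y.2 t) := by
      filter_upwards [hx, hy] with t h1 h2 ht
      refine ⟨(h1 ht).1.add (h2 ht).1, ?_⟩
      rw [intervalIntegral.integral_add (h1 ht).1 (h2 ht).1, (h1 ht).2, (h2 ht).2]
    refine h0.congr ?_ ?_
    · rw [← ae_expMeasure_iff (κ := κ)]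
      exact Lp.coeFn_add x.1 y.1
    · rw [← ae_expMeasure_iff (κ := κ)]
      exact Lp.coeFn_add x.2 y.2
  smul_mem' := by
    intro c x hx
    have h0 : HasJPlus β (fun t => c * x.1 t) (fun t => c * x.2 t) := by
      filter_upwards [hx] with t h1 ht
      refine ⟨(h1 ht).1.const_mul c, ?_⟩
      rw [intervalIntegral.integral_const_mul, (h1 ht).2]
    refine h0.congr ?_ ?_
    · rw [← ae_expMeasure_iff (κ := κ)]
      exact Lp.coeFn_smul c x.1
    · rw [← ae_expMeasure_iff (κ := κ)]
      exact Lp.coeFn_smul c x.2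

/-- The graph of `𝓙⁻` in `L^p((0, β), e^{κ t} dt)`: the pairs `(g, f)` with `f = ∫_t^β g`. -/
def JMinusGraph (p : ENNReal) [Fact (1 ≤ p)] (β : EReal) (κ : ℝ) :
    Submodule ℂ (Space p β κ × Space p β κ) where
  carrier := {x | HasJMinus β x.1 x.2}
  zero_mem' := by
    have h0 : HasJMinus β (fun _ => 0) (fun _ => 0) := by
      filter_upwards with t ht
      refine ⟨fun b _ _ => by simp, ?_⟩
      simp only [intervalIntegral.integral_zero]
      exact tendsto_const_nhds
    refine h0.congr ?_ ?_ <;>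
    · rw [← ae_expMeasure_iff (κ := κ)]
      exact Lp.coeFn_zero ℂ p (expMeasure β κ)
  add_mem' := by
    intro x y hx hy
    have h0 : HasJMinus β (fun t => x.1 t + y.1 t) (fun t => x.2 t + y.2 t) := by
      filter_upwards [hx, hy] with t h1 h2 ht
      refine ⟨fun b h b' => ((h1 ht).1 b h b').add ((h2 ht).1 b h b'), ?_⟩
      refine ((h1 ht).2.add (h2 ht).2).congr' ?_
      filter_upwards [comap_le_Ioo ht.2] with b hb
      rw [intervalIntegral.integral_add ((h1 ht).1 b hb.1 hb.2) ((h2 ht).1 b hb.1 hb.2)]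
    refine h0.congr ?_ ?_
    · rw [← ae_expMeasure_iff (κ := κ)]
      exact Lp.coeFn_add x.1 y.1
    · rw [← ae_expMeasure_iff (κ := κ)]
      exact Lp.coeFn_add x.2 y.2
  smul_mem' := by
    intro c x hx
    have h0 : HasJMinus β (fun t => c * x.1 t) (fun t => c * x.2 t) := by
      filter_upwards [hx] with t h1 ht
      refine ⟨fun b h b' => ((h1 ht).1 b h b').const_mul c, ?_⟩
      simp only [intervalIntegral.integral_const_mul]
      exact (h1 ht).2.const_mul c
    refine h0.congr ?_ ?_
    · rw [← ae_expMeasure_iff (κ := κ)]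
      exact Lp.coeFn_smul c x.1
    · rw [← ae_expMeasure_iff (κ := κ)]
      exact Lp.coeFn_smul c x.2

/-- The operator `𝓙⁺` in `L^p((0, β), e^{κ t} dt)`, with its maximal domain: the `g` for which
`∫_0^t g` exists and is again in the space. -/
def JPlus (p : ENNReal) [Fact (1 ≤ p)] (β : EReal) (κ : ℝ) :
    Space p β κ →ₗ.[ℂ] Space p β κ := (JPlusGraph p β κ).toLinearPMap

/-- The operator `𝓙⁻` in `L^p((0, β), e^{κ t} dt)`, with its maximal domain: the `g` for which
`∫_t^β g` exists and is again in the space. -/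
def JMinus (p : ENNReal) [Fact (1 ≤ p)] (β : EReal) (κ : ℝ) :
    Space p β κ →ₗ.[ℂ] Space p β κ := (JMinusGraph p β κ).toLinearPMap

theorem JPlus_graph (p : ENNReal) [Fact (1 ≤ p)] (β : EReal) (κ : ℝ) :
    (JPlus p β κ).graph = JPlusGraph p β κ := by
  refine Submodule.toLinearPMap_graph_eq _ ?_
  rintro ⟨g, f⟩ hx hg
  have hg0 : g = 0 := hg
  subst hg0
  have h1 : HasJPlus β (fun _ => 0) f := by
    refine HasJPlus.congr hx ?_ (by filter_upwards with t _; rfl)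
    have := Lp.coeFn_zero ℂ p (expMeasure β κ)
    filter_upwards [ae_expMeasure_iff.1 this] with t h ht using (h ht).symm
  refine Lp.ext ?_
  have h2 : ∀ᵐ t ∂(expMeasure β κ), f t = 0 := by
    rw [ae_expMeasure_iff]
    filter_upwards [h1] with t h ht
    simpa using (h ht).2
  filter_upwards [h2, Lp.coeFn_zero ℂ p (expMeasure β κ)] with t h h'
  exact h.trans h'.symm

theorem JMinus_graph (p : ENNReal) [Fact (1 ≤ p)] (β : EReal) (κ : ℝ) :
    (JMinus p β κ).graph = JMinusGraph p β κ := by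
  refine Submodule.toLinearPMap_graph_eq _ ?_
  rintro ⟨g, f⟩ hx hg
  have hg0 : g = 0 := hg
  subst hg0
  have h1 : HasJMinus β (fun _ => 0) f := by
    refine HasJMinus.congr hx ?_ (by filter_upwards with t _; rfl)
    have := Lp.coeFn_zero ℂ p (expMeasure β κ)
    filter_upwards [ae_expMeasure_iff.1 this] with t h ht using (h ht).symm
  refine Lp.ext ?_
  have h2 : ∀ᵐ t ∂(expMeasure β κ), f t = 0 := by
    rw [ae_expMeasure_iff]
    filter_upwards [h1] with t h ht
    have h3 := (h ht).2
    simp only [intervalIntegral.integral_zero] at h3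
    have := comap_neBot ht.2
    exact tendsto_nhds_unique h3 tendsto_const_nhds
  filter_upwards [h2, Lp.coeFn_zero ℂ p (expMeasure β κ)] with t h h'
  exact h.trans h'.symm

/-! ### Functions of operators -/

variable {X : Type*} [NormedAddCommGroup X] [NormedSpace ℂ X]

/-- The operator `J + δ I`, on the domain of `J`. -/
def shift (J : X →ₗ.[ℂ] X) (δ : ℝ) : X →ₗ.[ℂ] X where
  domain := J.domain
  toFun := J.toFun + (δ : ℂ) • J.domain.subtype

/-- `B` is the bounded, everywhere defined inverse of the operator `L`. -/
def IsBoundedInverse (L : X →ₗ.[ℂ] X) (B : X →L[ℂ] X) : Prop :=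
  (∀ x : L.domain, B (L x) = x) ∧ ∀ y : X, ∃ h : B y ∈ L.domain, L ⟨B y, h⟩ = y

/-- `F = f(T)` in the holomorphic (Riesz--Dunford) functional calculus of the bounded operator `T`:
`F = (2πi)⁻¹ ∮ f(z) (z - T)⁻¹ dz` over a circle that encloses the spectrum of `T` and lies, with
its interior, in the open set `U` on which `f` is holomorphic. -/
def IsDunford (U : Set ℂ) (f : ℂ → ℂ) (T F : X →L[ℂ] X) : Prop :=
  IsOpen U ∧ DifferentiableOn ℂ f U ∧
    ∃ (ζ : ℂ) (R : ℝ), 0 < R ∧ Metric.closedBall ζ R ⊆ U ∧ spectrum ℂ T ⊆ Metric.ball ζ R ∧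
      F = (2 * (Real.pi : ℂ) * Complex.I)⁻¹ • ∮ z in C(ζ, R), f z • resolvent T z

/-- `Q = f(a / J)`: for each `δ > 0` the operator `J + δ I` has a bounded inverse, `f` can be
evaluated at the bounded operator `a / (J + δ I)`, and
`Q g = lim_{δ → 0+} f(a / (J + δ I)) g` for all `g`. -/
def IsValueAtInverse (U : Set ℂ) (f : ℂ → ℂ) (a : ℂ) (J : X →ₗ.[ℂ] X) (Q : X →L[ℂ] X) : Prop :=
  ∃ B F : ℝ → X →L[ℂ] X,
    (∀ δ : ℝ, 0 < δ → IsBoundedInverse (shift J δ) (B δ) ∧ IsDunford U f (a • B δ) (F δ)) ∧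
      ∀ g : X, Tendsto (fun δ : ℝ => F δ g) (𝓝[>] 0) (𝓝 (Q g))

end IndefConv

end

/-!
The operators `𝓙⁺` and `𝓙⁻` are inverses of `d/dt` and `-d/dt`, and these generate, up to sign, the
translations to the right and to the left, cut off outside `(0, β)`. With the weight `e^{-ct}`
(respectively `e^{ct}`) the translations `S(s)`, `s ≥ 0`, form a strongly continuous semigroup of
contractions of the space (`isContractionSemigroup_translationSemigroup`). Write `-A` for its
generator, so that `J = A⁻¹`, and put `V δ = ∫_0^∞ δ⁻¹ e^{-s/δ} S(s) ds = (1 + δ A)⁻¹`, a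
contraction. Then `(J + δ)⁻¹ = A (1 + δ A)⁻¹ = δ⁻¹ (1 - V δ)` is the Yosida approximation of `A`,
and everything rests on the classical fact that `exp(-s (J + δ)⁻¹)` converges strongly to `S(s)`
(`IsContractionSemigroup.tendsto_exp_neg_yosida`).

Let `a = i` for `𝓙⁺` and `a = -i` for `𝓙⁻`. The Fourier transform of the kernel has the form `f(z) =
∫_0^∞ e^{a z s} k(s) ds`, and `a (J + δ)⁻¹` differs from `a / δ` by an operator of norm at most `1 /
δ`. A circle with centre `a / δ` and radius slightly larger than `1 / δ` therefore encloses the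
spectrum and stays in the half plane of holomorphy. Exchanging the two integrals (`dunford_laplace`)
and using the Neumann series for the exponential (`dunford_cexp`), the Dunford integral becomes
`∫_0^∞ k(s) exp(-s (J + δ)⁻¹) ds`. Since the exponentials are contractions, dominated convergence
gives the limit `∫_0^∞ k(s) S(s) ds` (`IsContractionSemigroup.isValueAtInverse_laplace`). By
Fubini's theorem this operator is pointwise the convolution in question
(`ae_laplace_translationSemigroup`).

That `δ⁻¹ (1 - V δ)` really is the inverse of `J + δ` on the maximal domain of `J` amounts to
solving a first order linear equation with an integrating factor. For `𝓙⁻` this uses in addition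
that `(V δ) y` vanishes at the endpoint `β`, which is where `p < ∞` enters for the second time; the
first is the strong continuity of the translations.
-/

noncomputable section

namespace IndefConv

/-! ### The Dunford integral of an exponential -/

section Dunford

variable {A : Type*} [NormedRing A] [NormedAlgebra ℂ A] [CompleteSpace A]

/-- The Neumann series of the resolvent outside a disc with centre `ζ`. -/
theorem mem_resolventSet_and_hasSum_resolvent {T : A} {ζ z : ℂ}
    (h : ‖T - algebraMap ℂ A ζ‖ < ‖z - ζ‖) :
    z ∈ resolventSet ℂ T ∧
      HasSum (fun n : ℕ => ((z - ζ) ^ (n + 1))⁻¹ • (T - algebraMap ℂ A ζ) ^ n)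
        (resolvent T z) := by
  have hz : z - ζ ≠ 0 := by
    intro h0
    rw [h0, norm_zero] at h
    exact absurd h (not_lt.2 (norm_nonneg _))
  set N := T - algebraMap ℂ A ζ with hN
  set x : A := (z - ζ)⁻¹ • N with hx
  have hx1 : ‖x‖ < 1 := by
    rw [hx, norm_smul, norm_inv, inv_mul_lt_iff₀ (norm_pos_iff.2 hz), mul_one]
    exact h
  have hs := summable_geometric_of_norm_lt_one hx1
  have hfac : algebraMap ℂ A z - T = (z - ζ) • (1 - x) := by
    rw [hx, smul_sub, smul_inv_smul₀ hz, hN, Algebra.algebraMap_eq_smul_one,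
      Algebra.algebraMap_eq_smul_one, sub_smul]
    abel
  have h1 : (algebraMap ℂ A z - T) * ((z - ζ)⁻¹ • ∑' n, x ^ n) = 1 := by
    rw [hfac, smul_mul_smul_comm, mul_inv_cancel₀ hz, one_smul]
    exact hs.one_sub_mul_tsum_pow
  have h2 : ((z - ζ)⁻¹ • ∑' n, x ^ n) * (algebraMap ℂ A z - T) = 1 := by
    rw [hfac, smul_mul_smul_comm, inv_mul_cancel₀ hz, one_smul]
    exact hs.tsum_pow_mul_one_sub
  refine ⟨spectrum.mem_resolventSet_of_left_right_inverse h1 h2, ?_⟩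
  have h3 : resolvent T z = (z - ζ)⁻¹ • ∑' n, x ^ n :=
    Ring.inverse_unit (⟨algebraMap ℂ A z - T, _, h1, h2⟩ : Aˣ)
  rw [h3]
  convert hs.hasSum.const_smul (z - ζ)⁻¹ using 2 with n
  rw [hx, smul_pow, smul_smul, pow_succ, mul_inv, inv_pow, mul_comm]

theorem continuousOn_resolvent (T : A) : ContinuousOn (resolvent T) (resolventSet ℂ T) :=
  fun _ hz => (spectrum.hasDerivAt_resolvent_const_left hz).continuousAt.continuousWithinAt

/-- The Cauchy coefficients of an exponential. -/
theorem circleIntegral_cexp_mul_inv_pow {ζ : ℂ} {R : ℝ} (hR : 0 < R) (w : ℂ) (n : ℕ) :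
    (2 * (Real.pi : ℂ) * Complex.I)⁻¹ *
      (∮ z in C(ζ, R), Complex.exp (w * z) * ((z - ζ) ^ (n + 1))⁻¹) =
      Complex.exp (w * ζ) * ((n.factorial : ℂ)⁻¹ * w ^ n) := by
  have h := DiffContOnCl.circleIntegral_one_div_sub_center_pow_smul (c := ζ) hR n
    (f := fun z => Complex.exp (w * z)) (Differentiable.diffContOnCl (by fun_prop))
  rw [iteratedDeriv_cexp_const_mul] at h
  have h' : (∮ z in C(ζ, R), Complex.exp (w * z) * ((z - ζ) ^ (n + 1))⁻¹) =
      ∮ z in C(ζ, R), (1 / (z - ζ) ^ (n + 1)) • Complex.exp (w * z) := by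
    congr 1
    ext z
    rw [smul_eq_mul, one_div, mul_comm]
  rw [h', h, smul_eq_mul]
  have := Complex.two_pi_I_ne_zero
  field_simp

/-- The Dunford integral of `z ↦ e^{w z}` over a circle around the disc of centre `ζ` and radius
`‖T - ζ‖` is the exponential series. -/
theorem dunford_cexp {T : A} {ζ : ℂ} {R : ℝ} (h : ‖T - algebraMap ℂ A ζ‖ < R) (w : ℂ) :
    (2 * (Real.pi : ℂ) * Complex.I)⁻¹ • (∮ z in C(ζ, R), Complex.exp (w * z) • resolvent T z) =
      NormedSpace.exp (w • T) := by
  let _ : NormedAlgebra ℚ A := NormedAlgebra.restrictScalars ℚ ℂ A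
  set N := T - algebraMap ℂ A ζ with hN
  have hR : 0 < R := (norm_nonneg _).trans_lt h
  have hq : ‖N‖ / R ∈ Ico (0 : ℝ) 1 :=
    ⟨div_nonneg (norm_nonneg _) hR.le, (div_lt_one hR).2 h⟩
  have hcirc : ∀ θ : ℝ, ‖circleMap ζ R θ - ζ‖ = R := fun θ => by
    simp [abs_of_pos hR]
  obtain ⟨M, hM⟩ : ∃ M, ∀ θ : ℝ, ‖Complex.exp (w * circleMap ζ R θ)‖ ≤ M := by
    obtain ⟨M, hM⟩ := (isCompact_sphere ζ R).exists_bound_of_continuousOn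
      (f := fun z => Complex.exp (w * z)) (by fun_prop)
    exact ⟨M, fun θ => hM _ (circleMap_mem_sphere _ hR.le θ)⟩
  have hM0 : 0 ≤ M := (norm_nonneg _).trans (hM 0)
  have hsum : HasSum (fun n : ℕ => ∮ z in C(ζ, R),
      (Complex.exp (w * z) * ((z - ζ) ^ (n + 1))⁻¹) • N ^ n)
      (∮ z in C(ζ, R), Complex.exp (w * z) • resolvent T z) := by
    refine intervalIntegral.hasSum_integral_of_dominated_convergence
      (fun n _ => R * (M * (R⁻¹ ^ (n + 1) * ‖N ^ n‖))) (fun n => ?_) (fun n => ?_) ?_ ?_ ?_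
    · refine Continuous.aestronglyMeasurable ?_
      simp only [deriv_circleMap]
      have : ∀ θ, (circleMap ζ R θ - ζ) ^ (n + 1) ≠ 0 := fun θ =>
        pow_ne_zero _ (sub_ne_zero.2 (circleMap_ne_center hR.ne'))
      fun_prop (disch := assumption)
    · refine Eventually.of_forall fun θ _ => ?_
      rw [norm_smul, norm_smul, norm_mul, norm_inv, norm_pow, hcirc, deriv_circleMap, mul_assoc,
        inv_pow]
      simp only [norm_mul, norm_circleMap_zero, Complex.norm_I, mul_one, abs_of_pos hR]
      gcongr
      exact hM θ
    · refine Eventually.of_forall fun θ _ => ?_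
      have hs : Summable fun n : ℕ => R⁻¹ ^ (n + 1) * ‖N ^ n‖ := by
        -- The algebra need not satisfy `‖1‖ = 1`, so the power `n = 0` needs a constant.
        have hle : ∀ n : ℕ, ‖N ^ n‖ ≤ max ‖(1 : A)‖ 1 * ‖N‖ ^ n := by
          intro n
          rcases n.eq_zero_or_pos with rfl | hn
          · simp
          · exact (norm_pow_le' N hn).trans
              (le_mul_of_one_le_left (by positivity) (le_max_right _ _))
        refine Summable.of_nonneg_of_le (fun n => by positivity) (fun n => ?_)
          ((summable_geometric_of_lt_one hq.1 hq.2).mul_left (R⁻¹ * max ‖(1 : A)‖ 1))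
        calc R⁻¹ ^ (n + 1) * ‖N ^ n‖ ≤ R⁻¹ ^ (n + 1) * (max ‖(1 : A)‖ 1 * ‖N‖ ^ n) := by
              gcongr
              exact hle n
          _ = R⁻¹ * max ‖(1 : A)‖ 1 * (‖N‖ / R) ^ n := by
              rw [div_pow, pow_succ, inv_pow]
              field_simp
      exact (hs.mul_left M).mul_left R
    · exact intervalIntegrable_const
    · refine Eventually.of_forall fun θ _ => HasSum.const_smul _ ?_
      have h1 := (mem_resolventSet_and_hasSum_resolvent (T := T) (ζ := ζ) (z := circleMap ζ R θ)
        (by rwa [hcirc])).2.const_smul (Complex.exp (w * circleMap ζ R θ))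
      simpa only [smul_smul] using h1
  have hsum2 := hsum.const_smul (2 * (Real.pi : ℂ) * Complex.I)⁻¹
  have hterm : ∀ n : ℕ, (2 * (Real.pi : ℂ) * Complex.I)⁻¹ • (∮ z in C(ζ, R),
      (Complex.exp (w * z) * ((z - ζ) ^ (n + 1))⁻¹) • N ^ n) =
      Complex.exp (w * ζ) • ((n.factorial : ℂ)⁻¹ • (w • N) ^ n) := by
    intro n
    rw [circleIntegral.integral_smul_const, smul_smul, circleIntegral_cexp_mul_inv_pow hR,
      smul_pow, smul_smul, smul_smul, mul_assoc]
  simp only [hterm] at hsum2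
  have hexp := (NormedSpace.exp_series_hasSum_exp' (𝕂 := ℂ) (w • N)).const_smul
    (Complex.exp (w * ζ))
  rw [hsum2.unique hexp]
  have hT : w • T = algebraMap ℂ A (w * ζ) + w • N := by
    rw [hN, smul_sub, map_mul, Algebra.smul_def, Algebra.smul_def]
    abel
  rw [hT, NormedSpace.exp_add_of_commute (Algebra.commutes _ _), Algebra.smul_def,
    Complex.exp_eq_exp_ℂ, NormedSpace.algebraMap_exp_comm]

end Dunford

/-! ### The Dunford integral of a Laplace type integral -/

section Laplace

variable {k : ℝ → ℝ} {η : ℝ}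

theorem norm_cexp_mul_ofReal (a z : ℂ) (s : ℝ) :
    ‖Complex.exp (a * z * s)‖ = Real.exp ((a * z).re * s) := by
  rw [Complex.norm_exp, Complex.re_mul_ofReal]

theorem aestronglyMeasurable_of_exp_mul {ρ : ℝ} {μ : Measure ℝ}
    (hk : Integrable (fun s => k s * Real.exp (ρ * s)) μ) : AEStronglyMeasurable k μ := by
  have h : k = fun s => (k s * Real.exp (ρ * s)) * Real.exp (-(ρ * s)) := by
    ext s
    rw [mul_assoc, ← Real.exp_add, add_neg_cancel, Real.exp_zero, mul_one]
  rw [h]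
  exact hk.aestronglyMeasurable.mul (by fun_prop)

/-- The Laplace type integral of a kernel with exponential decay is holomorphic on a half plane. -/
theorem differentiableOn_laplace
    (hk : ∀ ρ < η, IntegrableOn (fun s => k s * Real.exp (ρ * s)) (Ioi 0)) (a : ℂ) :
    DifferentiableOn ℂ (fun z : ℂ => ∫ s in Ioi (0 : ℝ), Complex.exp (a * z * s) * (k s : ℂ))
      {z : ℂ | (a * z).re < η} := by
  intro z₀ hz₀
  obtain ⟨ρ₁, h1, h1η⟩ := exists_between (show (a * z₀).re < η from hz₀)
  obtain ⟨ρ, h2, hρ⟩ := exists_between h1η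
  have hkm := aestronglyMeasurable_of_exp_mul (hk ρ hρ)
  have hopen : IsOpen {z : ℂ | (a * z).re < ρ₁} :=
    isOpen_lt (by fun_prop) continuous_const
  have hkmC : AEStronglyMeasurable (fun s => (k s : ℂ)) (volume.restrict (Ioi 0)) :=
    Complex.continuous_ofReal.comp_aestronglyMeasurable hkm
  have hmeas : ∀ z : ℂ, AEStronglyMeasurable (fun s : ℝ => Complex.exp (a * z * s) * (k s : ℂ))
      (volume.restrict (Ioi 0)) := fun z =>
    (Continuous.aestronglyMeasurable (by fun_prop)).mul hkmC
  have key := hasDerivAt_integral_of_dominated_loc_of_deriv_le (𝕜 := ℂ)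
    (μ := volume.restrict (Ioi (0 : ℝ)))
    (F := fun (z : ℂ) (s : ℝ) => Complex.exp (a * z * s) * (k s : ℂ))
    (F' := fun (z : ℂ) (s : ℝ) => (Complex.exp (a * z * s) * (a * s)) * (k s : ℂ))
    (bound := fun s => (‖a‖ * (ρ - ρ₁)⁻¹) * ‖k s * Real.exp (ρ * s)‖)
    (hopen.mem_nhds h1) (Eventually.of_forall hmeas) ?_ ?_ ?_ ?_ ?_
  · exact key.2.differentiableAt.differentiableWithinAt
  · refine Integrable.mono (hk ρ hρ) (hmeas z₀) ?_
    filter_upwards [self_mem_ae_restrict measurableSet_Ioi] with s hs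
    have hs' : (0 : ℝ) < s := hs
    rw [norm_mul, norm_cexp_mul_ofReal, Complex.norm_real, norm_mul, mul_comm,
      Real.norm_of_nonneg (Real.exp_pos _).le]
    gcongr
    exact (h1.trans h2).le
  · exact (Continuous.aestronglyMeasurable (by fun_prop)).mul hkmC
  · filter_upwards [self_mem_ae_restrict measurableSet_Ioi] with s hs z hz
    have hs' : (0 : ℝ) < s := hs
    have hz' : (a * z).re < ρ₁ := hz
    have hd : 0 < ρ - ρ₁ := sub_pos.2 h2
    -- The gap `ρ - ρ₁` absorbs the factor `s` produced by differentiation.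
    have hexp : s * Real.exp (ρ₁ * s) ≤ (ρ - ρ₁)⁻¹ * Real.exp (ρ * s) := by
      have h3 : (ρ - ρ₁) * s ≤ Real.exp ((ρ - ρ₁) * s) :=
        (le_add_of_nonneg_right zero_le_one).trans (Real.add_one_le_exp _)
      have h4 : Real.exp (ρ * s) = Real.exp ((ρ - ρ₁) * s) * Real.exp (ρ₁ * s) := by
        rw [← Real.exp_add]; ring_nf
      rw [h4, ← mul_assoc]
      gcongr
      rwa [inv_mul_eq_div, le_div_iff₀' hd]
    rw [norm_mul, norm_mul, norm_cexp_mul_ofReal, Complex.norm_real, norm_mul, norm_mul,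
      Complex.norm_real, Real.norm_of_nonneg (Real.exp_pos (ρ * s)).le, Real.norm_of_nonneg hs'.le]
    calc Real.exp ((a * z).re * s) * (‖a‖ * s) * ‖k s‖
        ≤ Real.exp (ρ₁ * s) * (‖a‖ * s) * ‖k s‖ := by gcongr
      _ = ‖a‖ * (s * Real.exp (ρ₁ * s)) * ‖k s‖ := by ring
      _ ≤ ‖a‖ * ((ρ - ρ₁)⁻¹ * Real.exp (ρ * s)) * ‖k s‖ := by gcongr
      _ = _ := by ring
  · exact ((hk ρ hρ).norm).const_mul _
  · refine Eventually.of_forall fun s z _ => ?_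
    have h5 : HasDerivAt (fun z : ℂ => a * z * (s : ℂ)) (a * s) z := by
      simpa using ((hasDerivAt_id z).const_mul a).mul_const (s : ℂ)
    exact h5.cexp.mul_const _

variable {A : Type*} [NormedRing A] [NormedAlgebra ℂ A] [CompleteSpace A]

/-- The Dunford integral of a Laplace type integral is the Laplace type integral of the
exponentials. -/
theorem dunford_laplace {T : A} {ζ a : ℂ} {R ρ : ℝ} (h : ‖T - algebraMap ℂ A ζ‖ < R)
    (hρ : ∀ z ∈ Metric.sphere ζ R, (a * z).re ≤ ρ)
    (hk : IntegrableOn (fun s => k s * Real.exp (ρ * s)) (Ioi 0)) :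
    (2 * (Real.pi : ℂ) * Complex.I)⁻¹ • (∮ z in C(ζ, R),
      (∫ s in Ioi (0 : ℝ), Complex.exp (a * z * s) * (k s : ℂ)) • resolvent T z) =
      ∫ s in Ioi (0 : ℝ), (k s : ℂ) • NormedSpace.exp ((s * a) • T) := by
  have hR : 0 < R := (norm_nonneg _).trans_lt h
  have hcirc : ∀ θ : ℝ, ‖circleMap ζ R θ - ζ‖ = R := fun θ => by
    simp [abs_of_pos hR]
  have hkm := aestronglyMeasurable_of_exp_mul hk
  have hkmC : AEStronglyMeasurable (fun s => (k s : ℂ)) (volume.restrict (Ioi 0)) :=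
    Complex.continuous_ofReal.comp_aestronglyMeasurable hkm
  have hres : Continuous fun θ : ℝ => resolvent T (circleMap ζ R θ) :=
    (continuousOn_resolvent T).comp_continuous (continuous_circleMap ζ R) fun θ =>
      (mem_resolventSet_and_hasSum_resolvent (by rwa [hcirc θ])).1
  obtain ⟨M, hM⟩ := isCompact_Icc.exists_bound_of_continuousOn
    (s := Icc (0 : ℝ) (2 * Real.pi)) hres.continuousOn
  have hint : Integrable (Function.uncurry fun (θ s : ℝ) => deriv (circleMap ζ R) θ •
      (Complex.exp (a * circleMap ζ R θ * s) * (k s : ℂ)) • resolvent T (circleMap ζ R θ))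
      ((volume.restrict (uIoc 0 (2 * Real.pi))).prod (volume.restrict (Ioi (0 : ℝ)))) := by
    have hb : Integrable (fun x : ℝ × ℝ => (R * M) * ‖k x.2 * Real.exp (ρ * x.2)‖)
        ((volume.restrict (uIoc 0 (2 * Real.pi))).prod (volume.restrict (Ioi (0 : ℝ)))) := by
      have : IsFiniteMeasure (volume.restrict (uIoc 0 (2 * Real.pi))) := by
        rw [uIoc_of_le Real.two_pi_pos.le]
        infer_instance
      exact (Integrable.comp_snd hk.norm _).const_mul _
    refine hb.mono' ?_ ?_
    · simp only [Function.uncurry_def, deriv_circleMap]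
      refine AEStronglyMeasurable.smul (Continuous.aestronglyMeasurable (by fun_prop)) ?_
      refine AEStronglyMeasurable.smul (AEStronglyMeasurable.mul
        (Continuous.aestronglyMeasurable (by fun_prop)) ?_) ?_
      · exact hkmC.comp_snd
      · exact (hres.comp continuous_fst).aestronglyMeasurable
    · rw [Measure.prod_restrict]
      filter_upwards [self_mem_ae_restrict (measurableSet_uIoc.prod measurableSet_Ioi)]
        with x hx
      have hx1 : x.1 ∈ Icc (0 : ℝ) (2 * Real.pi) := by
        have := hx.1
        rw [uIoc_of_le Real.two_pi_pos.le] at this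
        exact Ioc_subset_Icc_self this
      have hx2 : (0 : ℝ) < x.2 := hx.2
      simp only [Function.uncurry, deriv_circleMap]
      rw [norm_smul, norm_smul, norm_mul, norm_mul, norm_cexp_mul_ofReal, Complex.norm_real]
      simp only [norm_circleMap_zero, Complex.norm_I, mul_one, abs_of_pos hR]
      rw [norm_mul, Real.norm_of_nonneg (Real.exp_pos _).le, mul_assoc R]
      have hM0 : 0 ≤ M := (norm_nonneg _).trans (hM _ hx1)
      have h1 : Real.exp ((a * circleMap ζ R x.1).re * x.2) ≤ Real.exp (ρ * x.2) := by
        gcongr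
        exact hρ _ (circleMap_mem_sphere _ hR.le _)
      calc R * (Real.exp ((a * circleMap ζ R x.1).re * x.2) * ‖k x.2‖ *
            ‖resolvent T (circleMap ζ R x.1)‖)
          ≤ R * (Real.exp (ρ * x.2) * ‖k x.2‖ * M) := by
            gcongr
            exact hM _ hx1
        _ = _ := by ring
  have hswap := intervalIntegral_integral_swap hint
  have hleft : (∮ z in C(ζ, R),
      (∫ s in Ioi (0 : ℝ), Complex.exp (a * z * s) * (k s : ℂ)) • resolvent T z) =
      ∫ s in Ioi (0 : ℝ), (k s : ℂ) •
        ∮ z in C(ζ, R), Complex.exp (s * a * z) • resolvent T z := by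
    rw [circleIntegral]
    simp only [← integral_smul_const, ← integral_smul]
    rw [hswap]
    refine integral_congr_ae (Eventually.of_forall fun s => ?_)
    simp only [circleIntegral, ← intervalIntegral.integral_smul]
    refine intervalIntegral.integral_congr fun θ _ => ?_
    simp only [smul_smul]
    congr 1
    ring_nf
  rw [hleft, ← integral_smul]
  refine integral_congr_ae (Eventually.of_forall fun s => ?_)
  simp only
  rw [smul_comm, dunford_cexp h]

end Laplace

/-! ### Contraction semigroups and their averages -/

section Semigroup

variable {X : Type*} [NormedAddCommGroup X] [NormedSpace ℂ X]

/-- `S` restricted to `[0, ∞)` is a strongly continuous semigroup of contractions; the values at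
negative times are arbitrary. -/
structure IsContractionSemigroup (S : ℝ → X →L[ℂ] X) : Prop where
  apply_zero : S 0 = 1
  apply_add : ∀ s r, 0 ≤ s → 0 ≤ r → S (s + r) = S s * S r
  norm_le : ∀ s, 0 ≤ s → ‖S s‖ ≤ 1
  continuousOn : ∀ g, ContinuousOn (fun s => S s g) (Ici 0)

namespace IsContractionSemigroup

variable {S : ℝ → X →L[ℂ] X} (hS : IsContractionSemigroup S)
include hS

theorem norm_apply_le {s : ℝ} (hs : 0 ≤ s) (g : X) : ‖S s g‖ ≤ ‖g‖ :=
  (S s).le_of_opNorm_le (hS.norm_le s hs) g |>.trans_eq (one_mul _)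

theorem aestronglyMeasurable (g : X) :
    AEStronglyMeasurable (fun s => S s g) (volume.restrict (Ioi 0)) :=
  ((hS.continuousOn g).mono Ioi_subset_Ici_self).aestronglyMeasurable measurableSet_Ioi

theorem integrableOn {k : ℝ → ℝ} (hk : IntegrableOn k (Ioi 0)) (g : X) :
    IntegrableOn (fun s => (k s : ℂ) • S s g) (Ioi 0) := by
  refine Integrable.mono' (hk.norm.mul_const ‖g‖) ?_ ?_
  · exact (Complex.continuous_ofReal.comp_aestronglyMeasurable hk.aestronglyMeasurable).smul
      (hS.aestronglyMeasurable g)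
  · filter_upwards [self_mem_ae_restrict measurableSet_Ioi] with s hs
    rw [norm_smul, Complex.norm_real]
    gcongr
    exact hS.norm_apply_le (le_of_lt hs) g

/-- The operator `∫_0^∞ k(s) S(s) ds` for an integrable kernel `k`, as a strong Bochner integral. -/
def laplace {k : ℝ → ℝ} (hk : IntegrableOn k (Ioi 0)) : X →L[ℂ] X :=
  LinearMap.mkContinuous
    { toFun := fun g => ∫ s in Ioi (0 : ℝ), (k s : ℂ) • S s g
      map_add' := fun g h => by
        simp only [map_add, smul_add]
        exact integral_add (hS.integrableOn hk g) (hS.integrableOn hk h)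
      map_smul' := fun c g => by
        simp only [map_smul, RingHom.id_apply, smul_comm _ c]
        exact integral_smul c _ }
    (∫ s in Ioi (0 : ℝ), ‖k s‖) fun g => by
      rw [← integral_mul_const]
      refine norm_integral_le_of_norm_le (hk.norm.mul_const _) ?_
      filter_upwards [self_mem_ae_restrict measurableSet_Ioi] with s hs
      rw [norm_smul, Complex.norm_real]
      gcongr
      exact hS.norm_apply_le (le_of_lt hs) g

theorem laplace_apply {k : ℝ → ℝ} (hk : IntegrableOn k (Ioi 0)) (g : X) :
    hS.laplace hk g = ∫ s in Ioi (0 : ℝ), (k s : ℂ) • S s g := rfl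

theorem norm_laplace_le {k : ℝ → ℝ} (hk : IntegrableOn k (Ioi 0)) :
    ‖hS.laplace hk‖ ≤ ∫ s in Ioi (0 : ℝ), ‖k s‖ :=
  LinearMap.mkContinuous_norm_le _ (integral_nonneg fun _ => norm_nonneg _) _

theorem commute {s r : ℝ} (hs : 0 ≤ s) (hr : 0 ≤ r) : Commute (S s) (S r) := by
  rw [Commute, SemiconjBy, ← hS.apply_add s r hs hr, ← hS.apply_add r s hr hs, add_comm]

variable [CompleteSpace X]

theorem commute_laplace {k : ℝ → ℝ} (hk : IntegrableOn k (Ioi 0)) {r : ℝ} (hr : 0 ≤ r) :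
    Commute (S r) (hS.laplace hk) := by
  ext g
  change S r (hS.laplace hk g) = hS.laplace hk (S r g)
  rw [laplace_apply, laplace_apply, ← ContinuousLinearMap.integral_comp_comm _
    (hS.integrableOn hk g)]
  refine setIntegral_congr_fun measurableSet_Ioi fun s hs => ?_
  simp only [map_smul]
  congr 1
  exact congrArg (fun L : X →L[ℂ] X => L g) (hS.commute hr (le_of_lt hs)).eq

end IsContractionSemigroup

/-- The density of the exponential distribution with mean `δ`. -/
def expDensity (δ s : ℝ) : ℝ := δ⁻¹ * Real.exp (-(δ⁻¹ * s))

theorem expDensity_nonneg {δ : ℝ} (hδ : 0 < δ) (s : ℝ) : 0 ≤ expDensity δ s :=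
  mul_nonneg (inv_nonneg.2 hδ.le) (Real.exp_pos _).le

theorem integrableOn_expDensity {δ : ℝ} (hδ : 0 < δ) : IntegrableOn (expDensity δ) (Ioi 0) := by
  have := (integrableOn_exp_mul_Ioi (a := -δ⁻¹) (by simpa using hδ) 0).const_mul δ⁻¹
  simp only [neg_mul] at this
  exact this

theorem integral_expDensity {δ : ℝ} (hδ : 0 < δ) :
    ∫ s in Ioi (0 : ℝ), expDensity δ s = 1 := by
  have := integral_exp_mul_Ioi (a := -δ⁻¹) (by simpa using hδ) 0
  simp only [neg_mul] at this
  simp only [expDensity]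
  rw [integral_const_mul, this]
  field_simp
  simp

theorem integral_norm_expDensity {δ : ℝ} (hδ : 0 < δ) :
    ∫ s in Ioi (0 : ℝ), ‖expDensity δ s‖ = 1 := by
  simp only [Real.norm_of_nonneg (expDensity_nonneg hδ _)]
  exact integral_expDensity hδ

/-- Rescaling the exponential density to mean one. -/
theorem integral_expDensity_smul {δ : ℝ} (hδ : 0 < δ) (G : ℝ → X) :
    ∫ s in Ioi (0 : ℝ), (expDensity δ s : ℂ) • G s =
      ∫ u in Ioi (0 : ℝ), (Real.exp (-u) : ℂ) • G (δ * u) := by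
  have h := integral_comp_mul_left_Ioi (fun s => ((δ * expDensity δ s : ℝ) : ℂ) • G s) 0 hδ
  rw [mul_zero] at h
  have h2 : ∀ u : ℝ, δ * expDensity δ (δ * u) = Real.exp (-u) := fun u => by
    rw [expDensity, inv_mul_cancel_left₀ hδ.ne', mul_inv_cancel_left₀ hδ.ne']
  simp only [h2] at h
  rw [h, ← integral_smul]
  refine integral_congr_ae (Eventually.of_forall fun s => ?_)
  simp only
  rw [Complex.ofReal_mul, mul_smul, Complex.coe_smul δ, inv_smul_smul₀ hδ.ne']

/-- `V δ = (1 + δ A)⁻¹`, where `-A` is the generator, as an average of the semigroup. -/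
def IsContractionSemigroup.average {S : ℝ → X →L[ℂ] X} (hS : IsContractionSemigroup S) {δ : ℝ}
    (hδ : 0 < δ) : X →L[ℂ] X := hS.laplace (integrableOn_expDensity hδ)

end Semigroup

/-! ### Yosida approximation -/

/-- The norm of `1` is only assumed to be at most one, so that the operators on a trivial space are
included. -/
theorem norm_exp_le_of_norm_one_le {A : Type*} [NormedRing A] [NormedAlgebra ℂ A]
    [CompleteSpace A] (h1 : ‖(1 : A)‖ ≤ 1) (x : A) : ‖NormedSpace.exp x‖ ≤ Real.exp ‖x‖ := by
  have hR := NormedSpace.exp_series_hasSum_exp' (𝕂 := ℝ) ‖x‖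
  rw [← Real.exp_eq_exp_ℝ] at hR
  rw [← (NormedSpace.exp_series_hasSum_exp' (𝕂 := ℂ) x).tsum_eq]
  refine tsum_of_norm_bounded hR fun n => ?_
  rw [norm_smul, norm_inv, Complex.norm_natCast, smul_eq_mul]
  gcongr
  rcases n.eq_zero_or_pos with rfl | hn
  · simpa using h1
  · exact norm_pow_le' x hn

section Semigroup

variable {X : Type*} [NormedAddCommGroup X] [NormedSpace ℂ X]

namespace IsContractionSemigroup

variable {S : ℝ → X →L[ℂ] X} (hS : IsContractionSemigroup S)
include hS

/-- A right derivative of an orbit at `0` propagates along the orbit. -/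
theorem hasDerivWithinAt_orbit {g h : X} (hg : HasDerivWithinAt (fun s => S s g) h (Ici 0) 0)
    {r : ℝ} (hr : 0 ≤ r) : HasDerivWithinAt (fun s => S s g) (S r h) (Ici r) r := by
  have h1 : HasDerivWithinAt (fun y : ℝ => S (y - r) g) h (Ici r) r := by
    have h2 : HasDerivWithinAt (fun y : ℝ => y - r) 1 (Ici r) r :=
      ((hasDerivAt_id r).sub_const r).hasDerivWithinAt
    have h3 : HasDerivWithinAt (fun s => S s g) h (Ici 0) (r - r) := by rwa [sub_self]
    have := HasDerivWithinAt.scomp (h := fun y : ℝ => y - r) r h3 h2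
      fun y hy => sub_nonneg.2 (show r ≤ y from hy)
    simpa using! this
  have h4 := ((S r).restrictScalars ℝ).hasFDerivAt.comp_hasDerivWithinAt r h1
  refine h4.congr (fun y hy => ?_) ?_
  · have := hS.apply_add r (y - r) hr (sub_nonneg.2 hy)
    rw [add_sub_cancel] at this
    rw [this]
    rfl
  · simp [hS.apply_zero]

theorem norm_orbit_sub_le {g h : X} (hg : HasDerivWithinAt (fun s => S s g) h (Ici 0) 0)
    {r : ℝ} (hr : 0 ≤ r) : ‖S r g - g‖ ≤ ‖h‖ * r := by
  have := norm_image_sub_le_of_norm_deriv_right_le_segment (f := fun s => S s g)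
    (f' := fun s => S s h) (C := ‖h‖) (a := 0) (b := r)
    ((hS.continuousOn g).mono Icc_subset_Ici_self)
    (fun x hx => hS.hasDerivWithinAt_orbit hg hx.1)
    (fun x hx => hS.norm_apply_le hx.1 h) r ⟨hr, le_rfl⟩
  simpa [hS.apply_zero] using this

theorem norm_average_le {δ : ℝ} (hδ : 0 < δ) : ‖hS.average hδ‖ ≤ 1 :=
  (hS.norm_laplace_le _).trans_eq (integral_norm_expDensity hδ)

theorem average_apply {δ : ℝ} (hδ : 0 < δ) (g : X) :
    hS.average hδ g = ∫ u in Ioi (0 : ℝ), (Real.exp (-u) : ℂ) • S (δ * u) g := by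
  rw [average, laplace_apply, integral_expDensity_smul hδ]

theorem integrableOn_exp_smul {δ : ℝ} (hδ : 0 < δ) (g : X) :
    IntegrableOn (fun u : ℝ => (Real.exp (-u) : ℂ) • S (δ * u) g) (Ioi 0) := by
  refine Integrable.mono' ((integrableOn_exp_neg_Ioi 0).mul_const ‖g‖) ?_ ?_
  · refine ContinuousOn.aestronglyMeasurable (ContinuousOn.smul (by fun_prop) ?_) measurableSet_Ioi
    exact (hS.continuousOn g).comp (by fun_prop) fun u hu => (mul_pos hδ hu).le
  · filter_upwards [self_mem_ae_restrict measurableSet_Ioi] with u hu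
    rw [norm_smul, Complex.norm_real, Real.norm_of_nonneg (Real.exp_pos _).le]
    gcongr
    exact hS.norm_apply_le (mul_pos hδ hu).le g

variable [CompleteSpace X]

/-- `V δ g` comes arbitrarily close to `g`, because `V δ` converges strongly to the identity as
`δ → 0`. -/
theorem exists_norm_average_sub_lt (g : X) {ε : ℝ} (hε : 0 < ε) :
    ∃ (δ : ℝ) (hδ : 0 < δ), ‖hS.average hδ g - g‖ < ε := by
  have hlim : Tendsto (fun δ : ℝ => ∫ u in Ioi (0 : ℝ), (Real.exp (-u) : ℂ) • S (δ * u) g)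
      (𝓝[>] 0) (𝓝 (∫ u in Ioi (0 : ℝ), (Real.exp (-u) : ℂ) • g)) := by
    refine tendsto_integral_filter_of_dominated_convergence (fun u => Real.exp (-u) * ‖g‖)
      ?_ ?_ ?_ ?_
    · filter_upwards [self_mem_nhdsWithin] with δ hδ
      exact (hS.integrableOn_exp_smul hδ g).aestronglyMeasurable
    · filter_upwards [self_mem_nhdsWithin] with δ hδ
      filter_upwards [self_mem_ae_restrict measurableSet_Ioi] with u hu
      rw [norm_smul, Complex.norm_real, Real.norm_of_nonneg (Real.exp_pos _).le]
      gcongr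
      exact hS.norm_apply_le (mul_pos hδ hu).le g
    · exact (integrableOn_exp_neg_Ioi 0).mul_const ‖g‖
    · filter_upwards [self_mem_ae_restrict measurableSet_Ioi] with u hu
      refine Tendsto.const_smul ?_ _
      have h0 : Tendsto (fun s => S s g) (𝓝[Ici 0] 0) (𝓝 g) := by
        have := hS.continuousOn g 0 self_mem_Ici
        simpa only [ContinuousWithinAt, hS.apply_zero, one_apply_eq_self] using this
      refine h0.comp (tendsto_nhdsWithin_iff.2 ⟨?_, ?_⟩)
      · have : Tendsto (fun δ : ℝ => δ * u) (𝓝 0) (𝓝 (0 * u)) :=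
          tendsto_id.mul_const u
        rw [zero_mul] at this
        exact this.mono_left nhdsWithin_le_nhds
      · filter_upwards [self_mem_nhdsWithin] with δ hδ
        exact (mul_pos (show 0 < δ from hδ) (show 0 < u from hu)).le
  have hone : ∫ u in Ioi (0 : ℝ), (Real.exp (-u) : ℂ) • g = g := by
    rw [integral_smul_const, integral_complex_ofReal, integral_exp_neg_Ioi]
    simp
  rw [hone] at hlim
  obtain ⟨δ, h1, h2⟩ := ((Metric.tendsto_nhds.1 hlim ε hε).and self_mem_nhdsWithin).exists
  refine ⟨δ, h2, ?_⟩
  rw [hS.average_apply h2, ← dist_eq_norm]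
  exact h1

/-- On the domain of the generator the operators `δ⁻¹ (V δ - 1)` converge to the generator. -/
theorem tendsto_yosida {g h : X} (hg : HasDerivWithinAt (fun s => S s g) h (Ici 0) 0)
    {ε : ℝ} (hε : 0 < ε) :
    ∀ᶠ δ : ℝ in 𝓝[>] (0 : ℝ), ∀ hδ : 0 < δ, ‖(δ : ℂ)⁻¹ • (hS.average hδ g - g) - h‖ < ε := by
  have hgamma : IntegrableOn (fun u : ℝ => Real.exp (-u) * u) (Ioi 0) := by
    have := Real.GammaIntegral_convergent (s := 2) (by norm_num)
    refine this.congr_fun (fun u _ => ?_) measurableSet_Ioi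
    norm_num
  have hgamma1 : ∫ u in Ioi (0 : ℝ), Real.exp (-u) * u = 1 := by
    have := Real.Gamma_eq_integral (s := 2) (by norm_num)
    rw [Real.Gamma_two] at this
    rw [this]
    refine setIntegral_congr_fun measurableSet_Ioi fun u _ => ?_
    norm_num
  have hlim : Tendsto (fun δ : ℝ => ∫ u in Ioi (0 : ℝ),
      (Real.exp (-u) : ℂ) • (δ : ℂ)⁻¹ • (S (δ * u) g - g))
      (𝓝[>] 0) (𝓝 (∫ u in Ioi (0 : ℝ), (Real.exp (-u) : ℂ) • (u : ℂ) • h)) := by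
    refine tendsto_integral_filter_of_dominated_convergence (fun u => Real.exp (-u) * u * ‖h‖)
      ?_ ?_ ?_ ?_
    · filter_upwards [self_mem_nhdsWithin] with δ hδ
      refine ContinuousOn.aestronglyMeasurable (ContinuousOn.smul (by fun_prop) ?_)
        measurableSet_Ioi
      refine ContinuousOn.const_smul (ContinuousOn.sub ?_ continuousOn_const) _
      exact (hS.continuousOn g).comp (by fun_prop) fun u hu =>
        (mul_pos (show 0 < δ from hδ) (show 0 < u from hu)).le
    · filter_upwards [self_mem_nhdsWithin] with δ hδ
      filter_upwards [self_mem_ae_restrict measurableSet_Ioi] with u hu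
      have hδ' : (0 : ℝ) < δ := hδ
      rw [norm_smul, norm_smul, Complex.norm_real, Real.norm_of_nonneg (Real.exp_pos _).le,
        norm_inv, Complex.norm_real, Real.norm_of_nonneg hδ'.le, mul_assoc]
      have h3 : δ⁻¹ * ‖S (δ * u) g - g‖ ≤ u * ‖h‖ := by
        rw [inv_mul_le_iff₀ hδ']
        refine (hS.norm_orbit_sub_le hg (mul_pos hδ' hu).le).trans_eq ?_
        ring
      gcongr
    · exact hgamma.mul_const ‖h‖
    · filter_upwards [self_mem_ae_restrict measurableSet_Ioi] with u hu
      have hu' : (0 : ℝ) < u := hu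
      refine Tendsto.const_smul ?_ _
      have hslope := (hasDerivWithinAt_iff_tendsto_slope' self_notMem_Ioi).1 hg.Ioi_of_Ici
      have h1 : Tendsto (fun δ : ℝ => δ * u) (𝓝[>] 0) (𝓝[>] 0) := by
        refine tendsto_nhdsWithin_iff.2 ⟨?_, ?_⟩
        · have : Tendsto (fun δ : ℝ => δ * u) (𝓝 0) (𝓝 (0 * u)) :=
            tendsto_id.mul_const u
          rw [zero_mul] at this
          exact this.mono_left nhdsWithin_le_nhds
        · filter_upwards [self_mem_nhdsWithin] with δ hδ using mul_pos hδ hu'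
      refine ((hslope.comp h1).const_smul (u : ℂ)).congr fun δ => ?_
      simp only [Function.comp_apply, slope, hS.apply_zero, one_apply_eq_self,
        sub_zero, vsub_eq_sub]
      rw [← Complex.coe_smul, smul_smul]
      congr 1
      push_cast
      rw [mul_inv, mul_left_comm, mul_inv_cancel₀ (by exact_mod_cast hu'.ne'), mul_one]
  have hone : ∫ u in Ioi (0 : ℝ), (Real.exp (-u) : ℂ) • (u : ℂ) • h = h := by
    simp only [smul_smul, ← Complex.ofReal_mul]
    rw [integral_smul_const, integral_complex_ofReal, hgamma1]
    simp
  rw [hone] at hlim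
  filter_upwards [Metric.tendsto_nhds.1 hlim ε hε] with δ h1 hδ
  rw [dist_eq_norm] at h1
  have hexp : IntegrableOn (fun u : ℝ => (Real.exp (-u) : ℂ) • g) (Ioi 0) :=
    ((integrableOn_exp_neg_Ioi 0).ofReal (𝕜 := ℂ)).smul_const g
  have hone' : ∫ u in Ioi (0 : ℝ), (Real.exp (-u) : ℂ) • g = g := by
    rw [integral_smul_const, integral_complex_ofReal, integral_exp_neg_Ioi]
    simp
  have h2 : ∫ u in Ioi (0 : ℝ), (Real.exp (-u) : ℂ) • (δ : ℂ)⁻¹ • (S (δ * u) g - g) =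
      (δ : ℂ)⁻¹ • ∫ u in Ioi (0 : ℝ), ((Real.exp (-u) : ℂ) • S (δ * u) g -
        (Real.exp (-u) : ℂ) • g) := by
    rw [← integral_smul]
    simp only [smul_comm _ (δ : ℂ)⁻¹, smul_sub]
  rwa [h2, integral_sub (hS.integrableOn_exp_smul hδ g) hexp, hone', ← hS.average_apply hδ] at h1

/-- Averages of an orbit belong to the domain of the generator; with
`exists_norm_average_sub_lt` this makes the domain dense. -/
theorem hasDerivWithinAt_average {δ : ℝ} (hδ : 0 < δ) (y : X) :
    HasDerivWithinAt (fun s => S s (hS.average hδ y))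
      ((δ : ℂ)⁻¹ • (hS.average hδ y - y)) (Ici 0) 0 := by
  set F : ℝ → X := fun v => (expDensity δ v : ℂ) • S v y with hF
  have hFint : IntegrableOn F (Ioi 0) := hS.integrableOn (integrableOn_expDensity hδ) y
  have hFcont : ContinuousOn F (Ici 0) := by
    refine ContinuousOn.smul ?_ (hS.continuousOn y)
    unfold expDensity
    fun_prop
  have hV : hS.average hδ y = ∫ v in Ioi (0 : ℝ), F v := rfl
  have hFi : ∀ r : ℝ, 0 ≤ r → IntervalIntegrable F volume 0 r := fun r hr =>
    (hFcont.mono (by rw [uIcc_of_le hr]; exact Icc_subset_Ici_self)).intervalIntegrable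
  -- A translation of the integration variable makes the dependence on `r` explicit.
  have horbit : ∀ r : ℝ, 0 ≤ r → S r (hS.average hδ y) =
      (Real.exp (δ⁻¹ * r) : ℂ) • (hS.average hδ y - ∫ v in (0 : ℝ)..r, F v) := by
    intro r hr
    have h1 : hS.average hδ y - ∫ v in (0 : ℝ)..r, F v = ∫ v in Ioi r, F v := by
      rw [hV, sub_eq_iff_eq_add', intervalIntegral.integral_interval_add_Ioi' (hFi r hr)
        (hFint.mono_set (Ioi_subset_Ioi hr))]
    have h2 : ∫ v in Ioi r, F v = ∫ u in Ioi (0 : ℝ), F (u + r) := by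
      have := (measurePreserving_add_right volume r).setIntegral_preimage_emb
        (measurableEmbedding_addRight r) F (Ioi r)
      rw [← this]
      simp
    rw [h1, h2, hV, ← ContinuousLinearMap.integral_comp_comm _ hFint, ← integral_smul]
    refine setIntegral_congr_fun measurableSet_Ioi fun u hu => ?_
    have hu' : (0 : ℝ) ≤ u := le_of_lt hu
    simp only [hF, map_smul, smul_smul, ← Complex.ofReal_mul]
    have h3 : S (u + r) y = S r (S u y) := by
      rw [add_comm, hS.apply_add r u hr hu']
      rfl
    rw [h3]
    congr 2
    simp only [expDensity]
    rw [mul_left_comm, ← Real.exp_add]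
    ring_nf
  have hFTC : HasDerivWithinAt (fun r => ∫ v in (0 : ℝ)..r, F v) (F 0) (Ici 0) 0 := by
    refine intervalIntegral.integral_hasDerivWithinAt_right (by simp) (t := Ioi 0) ?_
      ((hFcont 0 self_mem_Ici).mono Ioi_subset_Ici_self)
    exact (hFcont.mono Ioi_subset_Ici_self).stronglyMeasurableAtFilter_nhdsWithin
      measurableSet_Ioi 0
  have hexp : HasDerivAt (fun r : ℝ => (Real.exp (δ⁻¹ * r) : ℂ)) (δ⁻¹ : ℂ) 0 := by
    have h4 : HasDerivAt (fun r : ℝ => Real.exp (δ⁻¹ * r)) δ⁻¹ 0 := by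
      simpa using ((hasDerivAt_id (0 : ℝ)).const_mul δ⁻¹).exp
    simpa using h4.ofReal_comp
  have hprod := hexp.hasDerivWithinAt (s := Ici 0) |>.smul
    ((hasDerivWithinAt_const (0 : ℝ) (Ici 0) (hS.average hδ y)).sub hFTC)
  refine (hprod.congr_deriv ?_).congr (fun r hr => horbit r hr) (horbit 0 le_rfl)
  simp [hF, expDensity, hS.apply_zero, smul_sub]
  abel

end IsContractionSemigroup
end Semigroup

section Semigroup

variable {X : Type*} [NormedAddCommGroup X] [NormedSpace ℂ X]

namespace IsContractionSemigroup

variable {S : ℝ → X →L[ℂ] X} (hS : IsContractionSemigroup S)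

/-- The Yosida approximation `δ⁻¹ (1 - V δ) = A (1 + δ A)⁻¹` of `A`, where `-A` generates `S`. -/
def yosida {δ : ℝ} (hδ : 0 < δ) : X →L[ℂ] X := (δ : ℂ)⁻¹ • (1 - hS.average hδ)

include hS
variable [CompleteSpace X]

/-- The contraction bound `‖exp(-s δ⁻¹ (1 - V δ))‖ ≤ e^{-s/δ} e^{(s/δ) ‖V δ‖} ≤ 1`. -/
theorem norm_exp_neg_yosida_le {δ : ℝ} (hδ : 0 < δ) {s : ℝ} (hs : 0 ≤ s) :
    ‖NormedSpace.exp (s • (-hS.yosida hδ))‖ ≤ 1 := by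
  let _ : NormedAlgebra ℚ (X →L[ℂ] X) := NormedAlgebra.restrictScalars ℚ ℂ _
  have h1 : s • (-hS.yosida hδ) =
      algebraMap ℂ (X →L[ℂ] X) (-(s * δ⁻¹ : ℝ)) + ((s * δ⁻¹ : ℝ) : ℂ) • hS.average hδ := by
    rw [yosida, Algebra.algebraMap_eq_smul_one, ← Complex.coe_smul, smul_neg, smul_smul, smul_sub,
      neg_smul]
    push_cast
    abel
  have hq : 0 ≤ s * δ⁻¹ := mul_nonneg hs (inv_nonneg.2 hδ.le)
  rw [h1, NormedSpace.exp_add_of_commute (Algebra.commutes _ _),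
    ← NormedSpace.algebraMap_exp_comm, ← Complex.exp_eq_exp_ℂ, ← Algebra.smul_def, norm_smul,
    ← Complex.ofReal_neg, ← Complex.ofReal_exp, Complex.norm_real,
    Real.norm_of_nonneg (Real.exp_pos _).le, Real.exp_neg]
  refine inv_mul_le_one_of_le₀ ?_ (Real.exp_pos _).le
  refine (norm_exp_le_of_norm_one_le ContinuousLinearMap.norm_id_le _).trans ?_
  gcongr
  rw [norm_smul, Complex.norm_real, Real.norm_of_nonneg hq]
  exact mul_le_of_le_one_right hq (hS.norm_average_le hδ)

theorem commute_yosida {δ : ℝ} (hδ : 0 < δ) {r : ℝ} (hr : 0 ≤ r) :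
    Commute (S r) (hS.yosida hδ) :=
  ((Commute.one_right _).sub_right (hS.commute_laplace _ hr)).smul_right _

/-- On the domain of the generator the semigroup and the exponentials of the Yosida approximations
differ by at most the time times the difference of the generators. -/
theorem norm_exp_neg_yosida_sub_le {δ : ℝ} (hδ : 0 < δ) {s : ℝ} (hs : 0 ≤ s) {g h : X}
    (hg : HasDerivWithinAt (fun s => S s g) h (Ici 0) 0) :
    ‖S s g - NormedSpace.exp (s • (-hS.yosida hδ)) g‖ ≤ ‖hS.yosida hδ g + h‖ * s := by
  set B := hS.yosida hδ with hB
  set E : ℝ → X →L[ℂ] X := fun r => NormedSpace.exp ((s - r) • (-B)) with hE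
  have hEd : ∀ r, HasDerivAt E (E r * B) r := by
    intro r
    have h1 := hasDerivAt_exp_smul_const (𝕂 := ℝ) (-B) (s - r)
    have h2 : HasDerivAt (fun r : ℝ => s - r) (-1) r := by
      simpa using (hasDerivAt_id r).const_sub s
    have := h1.scomp r h2
    simpa [hE, Function.comp_def] using! this
  have hEd' : ∀ r, HasDerivAt
      (fun r => ContinuousLinearMap.restrictScalarsL ℂ X X ℝ ℝ (E r))
      (ContinuousLinearMap.restrictScalarsL ℂ X X ℝ ℝ (E r * B)) r := fun r =>
    (ContinuousLinearMap.restrictScalarsL ℂ X X ℝ ℝ).hasFDerivAt.comp_hasDerivAt r (hEd r)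
  have hEcont : Continuous E := continuous_iff_continuousAt.2 fun r => (hEd r).continuousAt
  -- The function `r ↦ exp(-(s - r) B) S(r) g` interpolates between the two orbits.
  have key := norm_image_sub_le_of_norm_deriv_right_le_segment (f := fun r => E r (S r g))
    (f' := fun r => E r (S r (B g + h))) (C := ‖B g + h‖) (a := 0) (b := s) ?_ ?_ ?_ s
    ⟨hs, le_rfl⟩
  · simpa [hE, hS.apply_zero] using key
  · exact hEcont.continuousOn.clm_apply ((hS.continuousOn g).mono Icc_subset_Ici_self)
  · intro r hr
    have h3 := (hEd' r).hasDerivWithinAt (s := Ici r) |>.clm_apply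
      (hS.hasDerivWithinAt_orbit hg hr.1)
    refine h3.congr_deriv ?_
    have h4 : B (S r g) = S r (B g) :=
      (congrArg (fun L : X →L[ℂ] X => L g) (hS.commute_yosida hδ hr.1).eq).symm
    change E r (B (S r g)) + E r (S r h) = _
    rw [h4, ← map_add, ← map_add]
  · intro r hr
    refine ((E r).le_of_opNorm_le (hS.norm_exp_neg_yosida_le hδ (sub_nonneg.2 hr.2.le)) _).trans ?_
    rw [one_mul]
    exact hS.norm_apply_le hr.1 _

/-- The exponentials of the Yosida approximations converge strongly to the semigroup. -/
theorem tendsto_exp_neg_yosida {s : ℝ} (hs : 0 ≤ s) (g : X) {ε : ℝ} (hε : 0 < ε) :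
    ∀ᶠ δ : ℝ in 𝓝[>] 0, ∀ hδ : 0 < δ,
      ‖NormedSpace.exp (s • (-hS.yosida hδ)) g - S s g‖ < ε := by
  obtain ⟨η, hη, hclose⟩ := hS.exists_norm_average_sub_lt g (ε := ε / 3) (by positivity)
  set g' := hS.average hη g
  have hs1 : 0 < s + 1 := by positivity
  filter_upwards [hS.tendsto_yosida (hS.hasDerivWithinAt_average hη g)
    (ε := ε / 3 / (s + 1)) (by positivity)] with δ h1 hδ
  set E := NormedSpace.exp (s • (-hS.yosida hδ))
  have hE : ‖E‖ ≤ 1 := hS.norm_exp_neg_yosida_le hδ hs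
  have h2 : ‖S s g' - E g'‖ < ε / 3 := by
    refine (hS.norm_exp_neg_yosida_sub_le hδ hs (hS.hasDerivWithinAt_average hη g)).trans_lt ?_
    have h3 := h1 hδ
    rw [lt_div_iff₀ hs1] at h3
    refine lt_of_le_of_lt ?_ h3
    have h4 : hS.yosida hδ g' + (η : ℂ)⁻¹ • (g' - g) =
        -((δ : ℂ)⁻¹ • (hS.average hδ g' - g') - (η : ℂ)⁻¹ • (g' - g)) := by
      simp only [yosida, FunLike.coe_smul, Pi.smul_apply,
        FunLike.coe_sub, Pi.sub_apply, one_apply_eq_self, smul_sub]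
      abel
    rw [h4, norm_neg]
    gcongr
    linarith
  have h5 : E g - S s g = -(E (g' - g)) - (S s g' - E g') + S s (g' - g) := by
    simp only [map_sub]
    abel
  rw [h5]
  have h6 : ‖E (g' - g)‖ ≤ ‖g' - g‖ := by
    simpa using E.le_of_opNorm_le hE (g' - g)
  have h7 := hS.norm_apply_le hs (g' - g)
  calc ‖-(E (g' - g)) - (S s g' - E g') + S s (g' - g)‖
      ≤ ‖-(E (g' - g))‖ + ‖S s g' - E g'‖ + ‖S s (g' - g)‖ := by
        refine (norm_add_le _ _).trans ?_
        gcongr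
        exact norm_sub_le _ _
    _ < ε := by
        rw [norm_neg]
        linarith

/-- If `J + δ` has the inverse `δ⁻¹ (1 - V δ)` for every `δ > 0`, that is, if `J` is the inverse of
the negative of the generator of `S`, then `f(a / J)` is the operator `∫_0^∞ k(s) S(s) ds` when
`f(z) = ∫_0^∞ e^{a z s} k(s) ds` and `a² = -1`. -/
theorem isValueAtInverse_laplace {J : X →ₗ.[ℂ] X}
    (hJ : ∀ δ : ℝ, ∀ hδ : 0 < δ, IsBoundedInverse (shift J δ) (hS.yosida hδ))
    {k : ℝ → ℝ} {η : ℝ} (hη : 0 < η)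
    (hk : ∀ ρ < η, IntegrableOn (fun s => k s * Real.exp (ρ * s)) (Ioi 0))
    (hk0 : IntegrableOn k (Ioi 0)) {a : ℂ} (ha : a * a = -1) {f : ℂ → ℂ}
    (hf : ∀ z, f z = ∫ s in Ioi (0 : ℝ), Complex.exp (a * z * s) * (k s : ℂ)) :
    IsValueAtInverse {z : ℂ | (a * z).re < η} f a J (hS.laplace hk0) := by
  have hf' : f = fun z => ∫ s in Ioi (0 : ℝ), Complex.exp (a * z * s) * (k s : ℂ) := funext hf
  have hna : ‖a‖ = 1 := by
    have h1 : ‖a‖ * ‖a‖ = 1 := by rw [← norm_mul, ha, norm_neg, norm_one]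
    nlinarith [norm_nonneg a]
  set B : ℝ → X →L[ℂ] X := fun δ => if hδ : 0 < δ then hS.yosida hδ else 0 with hB
  have hBδ : ∀ δ (hδ : 0 < δ), B δ = hS.yosida hδ := fun δ hδ => by simp [hB, hδ]
  -- The disc of centre `a / δ` and radius `1 / δ`, which contains the spectrum of `a (J + δ)⁻¹`,
  -- touches the line `Re (a z) = 0`, so the radius may be enlarged by `η / 2`.
  set ζ : ℝ → ℂ := fun δ => a * (δ : ℂ)⁻¹
  set R : ℝ → ℝ := fun δ => δ⁻¹ + η / 2
  have hball : ∀ δ, 0 < δ → ∀ z ∈ Metric.closedBall (ζ δ) (R δ), (a * z).re ≤ η / 2 := by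
    intro δ hδ z hz
    have h2 : ‖a * (z - ζ δ)‖ ≤ R δ := by
      rw [norm_mul, hna, one_mul, ← dist_eq_norm]
      exact hz
    have h3 : a * (z - ζ δ) = a * z + ((δ⁻¹ : ℝ) : ℂ) := by
      rw [mul_sub, ← mul_assoc, ha]
      push_cast
      ring
    have h4 := (Complex.re_le_norm _).trans h2
    rw [h3, Complex.add_re, Complex.ofReal_re] at h4
    simp only [R] at h4
    linarith
  have hnorm : ∀ δ (hδ : 0 < δ), ‖a • B δ - algebraMap ℂ (X →L[ℂ] X) (ζ δ)‖ < R δ := by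
    intro δ hδ
    have h5 : a • B δ - algebraMap ℂ (X →L[ℂ] X) (ζ δ) =
        -((a * (δ : ℂ)⁻¹) • hS.average hδ) := by
      rw [hBδ δ hδ, yosida, Algebra.algebraMap_eq_smul_one, smul_smul, smul_sub]
      abel
    rw [h5, norm_neg, norm_smul, norm_mul, hna, one_mul, norm_inv, Complex.norm_real,
      Real.norm_of_nonneg hδ.le]
    have h6 := hS.norm_average_le hδ
    have h7 : δ⁻¹ * ‖hS.average hδ‖ ≤ δ⁻¹ := mul_le_of_le_one_right (by positivity) h6
    simp only [R]
    linarith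
  refine ⟨B, fun δ => (2 * (Real.pi : ℂ) * Complex.I)⁻¹ •
    ∮ z in C(ζ δ, R δ), f z • resolvent (a • B δ) z, fun δ hδ => ⟨?_, ?_, ?_, ζ δ, R δ,
      by positivity, ?_, ?_, rfl⟩, fun g => ?_⟩
  · rw [hBδ δ hδ]
    exact hJ δ hδ
  · exact isOpen_lt (by fun_prop) continuous_const
  · rw [hf']
    exact differentiableOn_laplace hk a
  · intro z hz
    exact (hball δ hδ z hz).trans_lt (half_lt_self hη)
  · intro z hz
    by_contra hzb
    refine hz (mem_resolventSet_and_hasSum_resolvent (ζ := ζ δ) ((hnorm δ hδ).trans_le ?_)).1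
    rw [Metric.mem_ball, not_lt, dist_eq_norm] at hzb
    exact hzb
  · have hF : ∀ δ, 0 < δ → ((2 * (Real.pi : ℂ) * Complex.I)⁻¹ •
        ∮ z in C(ζ δ, R δ), f z • resolvent (a • B δ) z) g =
        ∫ s in Ioi (0 : ℝ), (k s : ℂ) • NormedSpace.exp (s • (-B δ)) g := by
      intro δ hδ
      rw [hf', dunford_laplace (hnorm δ hδ)
        (fun z hz => hball δ hδ z (Metric.sphere_subset_closedBall hz)) (hk _ (half_lt_self hη))]
      have h8 : ∀ s : ℝ, (s * a) • a • B δ = s • (-B δ) := fun s => by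
        rw [smul_smul, mul_assoc, ha, ← Complex.coe_smul, smul_neg, mul_neg_one, neg_smul]
      simp only [h8]
      rw [ContinuousLinearMap.integral_apply]
      · rfl
      · have hc : Continuous fun s : ℝ => NormedSpace.exp (s • (-B δ)) :=
          continuous_iff_continuousAt.2 fun s =>
            (hasDerivAt_exp_smul_const (𝕂 := ℝ) (-B δ) s).continuousAt
        refine Integrable.mono' hk0.norm ?_ ?_
        · exact (Complex.continuous_ofReal.comp_aestronglyMeasurable
            hk0.aestronglyMeasurable).smul hc.aestronglyMeasurable
        · filter_upwards [self_mem_ae_restrict measurableSet_Ioi] with s hs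
          rw [norm_smul, Complex.norm_real, hBδ δ hδ]
          exact mul_le_of_le_one_right (norm_nonneg _)
            (hS.norm_exp_neg_yosida_le hδ (le_of_lt hs))
    rw [hS.laplace_apply]
    refine Tendsto.congr' (f₁ := fun δ => ∫ s in Ioi (0 : ℝ), (k s : ℂ) •
      NormedSpace.exp (s • (-B δ)) g) ?_ ?_
    · filter_upwards [self_mem_nhdsWithin] with δ hδ using (hF δ hδ).symm
    refine tendsto_integral_filter_of_dominated_convergence (fun s => ‖k s‖ * ‖g‖) ?_ ?_ ?_ ?_
    · refine Eventually.of_forall fun δ => ?_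
      have hc : Continuous fun s : ℝ => NormedSpace.exp (s • (-B δ)) :=
        continuous_iff_continuousAt.2 fun s =>
          (hasDerivAt_exp_smul_const (𝕂 := ℝ) (-B δ) s).continuousAt
      exact (Complex.continuous_ofReal.comp_aestronglyMeasurable
        hk0.aestronglyMeasurable).smul (hc.clm_apply continuous_const).aestronglyMeasurable
    · filter_upwards [self_mem_nhdsWithin] with δ hδ
      filter_upwards [self_mem_ae_restrict measurableSet_Ioi] with s hs
      rw [norm_smul, Complex.norm_real, hBδ δ hδ]
      gcongr
      simpa using (NormedSpace.exp (s • (-hS.yosida hδ))).le_of_opNorm_le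
        (hS.norm_exp_neg_yosida_le hδ (le_of_lt hs)) g
    · exact hk0.norm.mul_const _
    · filter_upwards [self_mem_ae_restrict measurableSet_Ioi] with s hs
      refine Tendsto.const_smul ?_ _
      refine Metric.tendsto_nhds.2 fun ε hε => ?_
      filter_upwards [hS.tendsto_exp_neg_yosida (le_of_lt hs) g hε, self_mem_nhdsWithin]
        with δ h9 hδ
      rw [hBδ δ hδ, dist_eq_norm]
      exact h9 hδ

end IsContractionSemigroup
end Semigroup

/-- For contractions, strong continuity at `0` implies strong continuity on `[0, ∞)`. -/
theorem IsContractionSemigroup.of_tendsto_zero {X : Type*} [NormedAddCommGroup X]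
    [NormedSpace ℂ X] {S : ℝ → X →L[ℂ] X} (h0 : S 0 = 1)
    (hadd : ∀ s r, 0 ≤ s → 0 ≤ r → S (s + r) = S s * S r) (hle : ∀ s, 0 ≤ s → ‖S s‖ ≤ 1)
    (hlim : ∀ g, Tendsto (fun s => S s g) (𝓝[≥] 0) (𝓝 g)) : IsContractionSemigroup S where
  apply_zero := h0
  apply_add := hadd
  norm_le := hle
  continuousOn g := by
    have hkey : ∀ s r, 0 ≤ s → s ≤ r → ‖S r g - S s g‖ ≤ ‖S (r - s) g - g‖ := by
      intro s r hs hsr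
      have h1 : S r g - S s g = S s (S (r - s) g - g) := by
        have := hadd s (r - s) hs (sub_nonneg.2 hsr)
        rw [add_sub_cancel] at this
        rw [this, map_sub]
        rfl
      rw [h1]
      simpa using (S s).le_of_opNorm_le (hle s hs) (S (r - s) g - g)
    intro r hr
    have hr' : (0 : ℝ) ≤ r := hr
    rw [ContinuousWithinAt, tendsto_iff_norm_sub_tendsto_zero]
    have h2 : Tendsto (fun s => ‖S |s - r| g - g‖) (𝓝[Ici 0] r) (𝓝 0) := by
      refine (tendsto_iff_norm_sub_tendsto_zero.1 (hlim g)).comp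
        (tendsto_nhdsWithin_iff.2 ⟨?_, Eventually.of_forall fun s => mem_Ici.2 (abs_nonneg _)⟩)
      have h3 : Tendsto (fun s : ℝ => |s - r|) (𝓝 r) (𝓝 |r - r|) :=
        (Continuous.tendsto (by fun_prop) r)
      rw [sub_self, abs_zero] at h3
      exact h3.mono_left nhdsWithin_le_nhds
    refine squeeze_zero' (Eventually.of_forall fun s => norm_nonneg _) ?_ h2
    filter_upwards [self_mem_nhdsWithin] with s hs
    rcases le_total s r with h | h
    · rw [norm_sub_rev, abs_sub_comm, abs_of_nonneg (sub_nonneg.2 h)]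
      exact hkey s r hs h
    · rw [abs_of_nonneg (sub_nonneg.2 h)]
      exact hkey r s hr' h

/-- Dominated convergence to zero in `L^p`. -/
theorem tendsto_eLpNorm_zero_of_dominated {α ι E : Type*} [MeasurableSpace α] {μ : Measure α}
    [NormedAddCommGroup E] {l : Filter ι} [l.IsCountablyGenerated] {p : ENNReal} (hp0 : p ≠ 0)
    (hp : p ≠ ⊤) {F : ι → α → E} {b : α → ℝ} (hF : ∀ᶠ n in l, AEStronglyMeasurable (F n) μ)
    (hb : MemLp b p μ) (hle : ∀ᶠ n in l, ∀ᵐ t ∂μ, ‖F n t‖ ≤ b t)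
    (hlim : ∀ᵐ t ∂μ, Tendsto (fun n => F n t) l (𝓝 0)) :
    Tendsto (fun n => eLpNorm (F n) p μ) l (𝓝 0) := by
  have hpt : 0 < p.toReal := ENNReal.toReal_pos hp0 hp
  simp only [eLpNorm_eq_lintegral_rpow_enorm_toReal hp0 hp]
  have h1 : Tendsto (fun n => ∫⁻ t, ‖F n t‖ₑ ^ p.toReal ∂μ) l (𝓝 (∫⁻ _, 0 ∂μ)) := by
    refine tendsto_lintegral_filter_of_dominated_convergence'
      (fun t => ‖b t‖ₑ ^ p.toReal) ?_ ?_ ?_ ?_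
    · filter_upwards [hF] with n hn using hn.enorm.pow_const _
    · filter_upwards [hle] with n hn
      filter_upwards [hn] with t ht
      gcongr
      rw [enorm_le_iff_norm_le]
      exact ht.trans (le_abs_self _)
    · exact (lintegral_rpow_enorm_lt_top_of_eLpNorm_lt_top hp0 hp hb.2).ne
    · filter_upwards [hlim] with t ht
      have h2 := (ENNReal.continuous_rpow_const (y := p.toReal)).tendsto _ |>.comp ht.enorm
      simpa [Function.comp_def, hpt] using h2
  rw [lintegral_zero] at h1
  have h3 := (ENNReal.continuous_rpow_const (y := 1 / p.toReal)).tendsto _ |>.comp h1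
  simpa [Function.comp_def, hpt] using h3

/-! ### Translations of `L^p((0, β), e^{κ t} dt)` -/

/-- The translate by `d` of the extension of `g` by zero from `(0, β)` to the real line. -/
def translate (β : EReal) (d : ℝ) (g : ℝ → ℂ) (t : ℝ) : ℂ := (interval β).indicator g (t - d)

theorem isOpen_interval (β : EReal) : IsOpen (interval β) :=
  isOpen_Ioi.inter (isOpen_Iio.preimage continuous_coe_real_ereal)

theorem ordConnected_interval (β : EReal) : (interval β).OrdConnected :=
  ⟨fun _ hx _ hy _ hz => ⟨hx.1.trans_le hz.1,
    lt_of_le_of_lt (EReal.coe_le_coe_iff.2 hz.2) hy.2⟩⟩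

instance (β : EReal) (κ : ℝ) : IsLocallyFiniteMeasure (expMeasure β κ) :=
  IsLocallyFiniteMeasure.withDensity_ofReal (by fun_prop)

theorem ae_mem_interval (β : EReal) (κ : ℝ) : ∀ᵐ t ∂(expMeasure β κ), t ∈ interval β :=
  ae_expMeasure_iff.2 (Eventually.of_forall fun _ h => h)

theorem expMeasure_apply (β : EReal) (κ : ℝ) {A : Set ℝ} (hA : MeasurableSet A) :
    expMeasure β κ A = ∫⁻ t in A ∩ interval β, ENNReal.ofReal (Real.exp (κ * t)) := by
  rw [expMeasure, withDensity_apply _ hA, Measure.restrict_restrict hA]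

/-- Translation in the direction in which the weight decreases does not increase the measure. -/
theorem restrict_map_expMeasure_le (β : EReal) {κ d : ℝ} (hd : κ * d ≤ 0) :
    ((expMeasure β κ).map (fun t => t - d)).restrict (interval β) ≤ expMeasure β κ := by
  refine Measure.le_iff.2 fun A hA => ?_
  have hAI := hA.inter (measurableSet_interval β)
  rw [Measure.restrict_apply hA, Measure.map_apply (by fun_prop) hAI,
    expMeasure_apply β κ (measurableSet_preimage (by fun_prop) hAI), expMeasure_apply β κ hA]
  calc ∫⁻ t in (fun t => t - d) ⁻¹' (A ∩ interval β) ∩ interval β,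
        ENNReal.ofReal (Real.exp (κ * t))
      ≤ ∫⁻ t in (fun t => t - d) ⁻¹' (A ∩ interval β), ENNReal.ofReal (Real.exp (κ * t)) :=
        lintegral_mono_set inter_subset_left
    _ ≤ ∫⁻ t in (fun t => t - d) ⁻¹' (A ∩ interval β),
          ENNReal.ofReal (Real.exp (κ * (t - d))) := by
        refine lintegral_mono fun t => ENNReal.ofReal_le_ofReal (Real.exp_le_exp.2 ?_)
        linarith
    _ = ∫⁻ t in A ∩ interval β, ENNReal.ofReal (Real.exp (κ * t)) :=
        (measurePreserving_sub_right volume d).setLIntegral_comp_preimage hAI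
          (f := fun t => ENNReal.ofReal (Real.exp (κ * t))) (by fun_prop)

section

variable {β : EReal} {κ d : ℝ} {p : ENNReal}

theorem translate_congr (hd : κ * d ≤ 0) {g g' : ℝ → ℂ} (h : g =ᵐ[expMeasure β κ] g') :
    translate β d g =ᵐ[expMeasure β κ] translate β d g' := by
  have h1 := ae_mono (restrict_map_expMeasure_le β hd) h
  have h2 := (ae_restrict_iff' (measurableSet_interval β)).1 h1
  filter_upwards [ae_of_ae_map (by fun_prop) h2] with t ht
  by_cases hI : t - d ∈ interval β
  · simp [translate, hI, ht hI]
  · simp [translate, hI]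

theorem aestronglyMeasurable_translate (hd : κ * d ≤ 0) {g : ℝ → ℂ}
    (hg : AEStronglyMeasurable g (expMeasure β κ)) :
    AEStronglyMeasurable (translate β d g) (expMeasure β κ) :=
  ((aestronglyMeasurable_indicator_iff (measurableSet_interval β)).2
    (hg.mono_measure (restrict_map_expMeasure_le β hd))).comp_measurable (by fun_prop)

theorem eLpNorm_translate_le (hd : κ * d ≤ 0) {g : ℝ → ℂ}
    (hg : AEStronglyMeasurable g (expMeasure β κ)) :
    eLpNorm (translate β d g) p (expMeasure β κ) ≤ eLpNorm g p (expMeasure β κ) := by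
  have h1 := eLpNorm_map_measure (p := p) ((aestronglyMeasurable_indicator_iff
    (measurableSet_interval β)).2 (hg.mono_measure (restrict_map_expMeasure_le β hd)))
    (f := fun t => t - d) (μ := expMeasure β κ) (by fun_prop)
  calc eLpNorm (translate β d g) p (expMeasure β κ)
      = eLpNorm ((interval β).indicator g) p ((expMeasure β κ).map fun t => t - d) := h1.symm
    _ = eLpNorm g p (((expMeasure β κ).map fun t => t - d).restrict (interval β)) :=
        eLpNorm_indicator_eq_eLpNorm_restrict (measurableSet_interval β)
    _ ≤ _ := eLpNorm_mono_measure _ (restrict_map_expMeasure_le β hd)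

theorem memLp_translate (hd : κ * d ≤ 0) {g : ℝ → ℂ} (hg : MemLp g p (expMeasure β κ)) :
    MemLp (translate β d g) p (expMeasure β κ) :=
  ⟨aestronglyMeasurable_translate hd hg.1, (eLpNorm_translate_le hd hg.1).trans_lt hg.2⟩

variable [Fact (1 ≤ p)]

/-- Translation by `d`, as a contraction of `L^p((0, β), e^{κ t} dt)`. -/
def translateLp (p : ENNReal) [Fact (1 ≤ p)] (β : EReal) (hd : κ * d ≤ 0) :
    Space p β κ →L[ℂ] Space p β κ :=
  LinearMap.mkContinuous
    { toFun := fun g => (memLp_translate hd (Lp.memLp g)).toLp _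
      map_add' := fun g h => by
        refine Lp.ext ?_
        filter_upwards [MemLp.coeFn_toLp (memLp_translate hd (Lp.memLp (g + h))),
          Lp.coeFn_add ((memLp_translate hd (Lp.memLp g)).toLp _)
            ((memLp_translate hd (Lp.memLp h)).toLp _),
          MemLp.coeFn_toLp (memLp_translate hd (Lp.memLp g)),
          MemLp.coeFn_toLp (memLp_translate hd (Lp.memLp h)),
          translate_congr hd (Lp.coeFn_add g h)] with t h1 h2 h3 h4 h5
        rw [h1, h2, h5, Pi.add_apply, h3, h4, translate, indicator_add']
        rfl
      map_smul' := fun c g => by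
        refine Lp.ext ?_
        filter_upwards [MemLp.coeFn_toLp (memLp_translate hd (Lp.memLp (c • g))),
          Lp.coeFn_smul c ((memLp_translate hd (Lp.memLp g)).toLp _),
          MemLp.coeFn_toLp (memLp_translate hd (Lp.memLp g)),
          translate_congr hd (Lp.coeFn_smul c g)] with t h1 h2 h3 h5
        rw [h1, RingHom.id_apply, h2, h5, Pi.smul_apply, h3, translate, translate]
        exact congrFun (indicator_const_smul _ c _) _ }
    1 fun g => by
      rw [one_mul]
      change ‖(memLp_translate hd (Lp.memLp g)).toLp _‖ ≤ ‖g‖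
      rw [Lp.norm_toLp, Lp.norm_def]
      exact ENNReal.toReal_mono (Lp.memLp g).2.ne
        (eLpNorm_translate_le hd (Lp.memLp g).1)

theorem coeFn_translateLp (hd : κ * d ≤ 0) (g : Space p β κ) :
    translateLp p β hd g =ᵐ[expMeasure β κ] translate β d g :=
  MemLp.coeFn_toLp (memLp_translate hd (Lp.memLp g))

theorem norm_translateLp_le (hd : κ * d ≤ 0) : ‖translateLp p β hd‖ ≤ 1 :=
  LinearMap.mkContinuous_norm_le _ zero_le_one _

end

/-- The translates of a compactly supported continuous function depend continuously in `L^p` on the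
translation. -/
theorem tendsto_eLpNorm_translate_sub (β : EReal) (κ : ℝ) {p : ENNReal} (hp0 : p ≠ 0)
    (hp : p ≠ ⊤) {f : ℝ → ℂ} (hf : Continuous f) (hc : HasCompactSupport f) :
    Tendsto (fun d => eLpNorm (fun t => translate β d f t - f t) p (expMeasure β κ))
      (𝓝 0) (𝓝 0) := by
  obtain ⟨r, hr, hfr⟩ := hc.exists_pos_le_norm
  obtain ⟨M, hM⟩ := hf.bounded_above_of_compact_support hc
  have hM0 : 0 ≤ M := (norm_nonneg _).trans (hM 0)
  have htr : ∀ d t, ‖translate β d f t‖ ≤ M := fun d t =>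
    (norm_indicator_le_norm_self _ _).trans (hM _)
  refine tendsto_eLpNorm_zero_of_dominated hp0 hp
    (b := (Icc (-(r + 1)) (r + 1)).indicator fun _ => M + M) ?_ ?_ ?_ ?_
  · refine Eventually.of_forall fun d => ?_
    refine AEStronglyMeasurable.sub ?_ hf.aestronglyMeasurable
    exact ((hf.stronglyMeasurable.indicator (measurableSet_interval β)).comp_measurable
      (by fun_prop)).aestronglyMeasurable
  · exact memLp_indicator_const p measurableSet_Icc _
      (Or.inr isCompact_Icc.measure_lt_top.ne)
  · filter_upwards [Metric.ball_mem_nhds (0 : ℝ) one_pos] with d hd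
    rw [mem_ball_zero_iff, Real.norm_eq_abs, abs_lt] at hd
    refine Eventually.of_forall fun t => ?_
    by_cases ht : t ∈ Icc (-(r + 1)) (r + 1)
    · rw [indicator_of_mem ht]
      exact (norm_sub_le _ _).trans (add_le_add (htr d t) (hM t))
    -- Outside `[-(r + 1), r + 1]` both terms vanish, since `|d| < 1`.
    · have hz : ∀ x : ℝ, |x - t| ≤ 1 → f x = 0 := by
        intro x hx
        refine hfr x ?_
        rw [Real.norm_eq_abs]
        by_contra hlt
        push Not at hlt
        rw [abs_lt] at hlt
        rw [abs_le] at hx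
        exact ht ⟨by linarith [hlt.1, hx.2], by linarith [hlt.2, hx.1]⟩
      have h1 : f t = 0 := hz t (by simp)
      have h2 : f (t - d) = 0 := hz (t - d) (by
        rw [abs_le]; constructor <;> linarith [hd.1, hd.2])
      have h3 : translate β d f t = 0 := indicator_apply_eq_zero.2 fun _ => h2
      rw [indicator_of_notMem ht, h1, h3]
      simp
  · filter_upwards [ae_mem_interval β κ] with t ht
    have h1 : Tendsto (fun d : ℝ => t - d) (𝓝 0) (𝓝 t) := by
      have := (show Continuous fun d : ℝ => t - d by fun_prop).tendsto 0
      rwa [sub_zero] at this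
    have h2 : Tendsto (fun d : ℝ => f (t - d) - f t) (𝓝 0) (𝓝 0) := by
      have := ((hf.tendsto t).comp h1).sub_const (f t)
      simpa [Function.comp_def] using this
    refine h2.congr' ?_
    filter_upwards [h1.eventually ((isOpen_interval β).mem_nhds ht)] with d hd
    rw [translate, indicator_of_mem (show t - d ∈ interval β from hd)]

section

variable {β : EReal} {κ σ : ℝ}

theorem mul_mul_nonpos (hσ : κ * σ ≤ 0) {s : ℝ} (hs : 0 ≤ s) : κ * (σ * s) ≤ 0 := by
  rw [← mul_assoc]
  exact mul_nonpos_of_nonpos_of_nonneg hσ hs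

/-- The semigroup of translations with velocity `σ`, that is, to the right for `σ = 1` and to the
left for `σ = -1`; the value at negative times is immaterial. -/
def translationSemigroup (p : ENNReal) [Fact (1 ≤ p)] (β : EReal) (hσ : κ * σ ≤ 0) (s : ℝ) :
    Space p β κ →L[ℂ] Space p β κ :=
  if hs : 0 ≤ s then translateLp p β (mul_mul_nonpos hσ hs) else 0

variable {p : ENNReal} [Fact (1 ≤ p)]

theorem coeFn_translationSemigroup (hσ : κ * σ ≤ 0) {s : ℝ} (hs : 0 ≤ s) (g : Space p β κ) :
    translationSemigroup p β hσ s g =ᵐ[expMeasure β κ] translate β (σ * s) g := by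
  rw [translationSemigroup, dif_pos hs]
  exact coeFn_translateLp _ g

theorem isContractionSemigroup_translationSemigroup (hp : p ≠ ⊤) (hσ : κ * σ ≤ 0) :
    IsContractionSemigroup (translationSemigroup p β hσ) := by
  have hp0 : p ≠ 0 := (zero_lt_one.trans_le Fact.out).ne'
  have hle : ∀ s, 0 ≤ s → ‖translationSemigroup p β hσ s‖ ≤ 1 := fun s hs => by
    rw [translationSemigroup, dif_pos hs]
    exact norm_translateLp_le _
  refine .of_tendsto_zero ?_ ?_ hle ?_
  · ext1 g
    refine Lp.ext ?_
    filter_upwards [coeFn_translationSemigroup hσ le_rfl g, ae_mem_interval β κ] with t h1 h2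
    rw [h1]
    simp [translate, h2]
  · intro s r hs hr
    ext1 g
    refine Lp.ext ?_
    filter_upwards [coeFn_translationSemigroup hσ (add_nonneg hs hr) g,
      coeFn_translationSemigroup hσ hs (translationSemigroup p β hσ r g),
      translate_congr (mul_mul_nonpos hσ hs) (coeFn_translationSemigroup hσ hr g),
      ae_mem_interval β κ] with t h1 h2 h3 h4
    rw [mul_apply_eq_comp, h1, h2, h3]
    have h5 : t - σ * (s + r) = t - σ * s - σ * r := by ring
    by_cases hI : t - σ * s ∈ interval β
    · simp only [translate, indicator_of_mem hI, h5]
    -- Once a point has left the interval it does not come back: `t - σ s` lies between `t` and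
    -- `t - σ (s + r)`.
    · have h6 : t - σ * (s + r) ∉ interval β := by
        intro h7
        refine hI ((ordConnected_interval β).uIcc_subset h4 h7 ?_)
        rw [mem_uIcc]
        have hsr : s ≤ s + r := le_add_of_nonneg_right hr
        rcases le_total 0 σ with h | h
        · right
          constructor
          · nlinarith
          · nlinarith
        · left
          constructor
          · nlinarith
          · nlinarith
      simp only [translate, indicator_of_notMem hI, indicator_of_notMem h6]
  · intro g
    refine Metric.tendsto_nhds.2 fun ε hε => ?_
    obtain ⟨f, hfc, hfg, hf, hfm⟩ := (Lp.memLp g).exists_hasCompactSupport_eLpNorm_sub_le hp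
      (ε := ENNReal.ofReal (ε / 3)) (by simpa using hε)
    set F : Space p β κ := hfm.toLp f
    have hgF : ‖g - F‖ ≤ ε / 3 := by
      rw [Lp.norm_def]
      refine ENNReal.toReal_le_of_le_ofReal (by positivity) (le_of_eq_of_le ?_ hfg)
      refine eLpNorm_congr_ae ?_
      filter_upwards [Lp.coeFn_sub g F, hfm.coeFn_toLp] with t h1 h2
      rw [h1, Pi.sub_apply, h2, Pi.sub_apply]
    have hlim : Tendsto (fun s : ℝ => eLpNorm (fun t => translate β (σ * s) f t - f t) p
        (expMeasure β κ)) (𝓝[≥] 0) (𝓝 0) := by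
      refine (tendsto_eLpNorm_translate_sub β κ hp0 hp hf hfc).comp ?_
      have : Tendsto (fun s : ℝ => σ * s) (𝓝 0) (𝓝 (σ * 0)) := tendsto_id.const_mul σ
      rw [mul_zero] at this
      exact this.mono_left nhdsWithin_le_nhds
    have hpos : (0 : ENNReal) < ENNReal.ofReal (ε / 3) := by simpa using hε
    filter_upwards [hlim.eventually_lt_const hpos, self_mem_nhdsWithin] with s h1 hs
    have hs' : (0 : ℝ) ≤ s := hs
    set L := translationSemigroup p β hσ s
    have h2 : ‖L F - F‖ < ε / 3 := by
      rw [Lp.norm_def]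
      have h3 : eLpNorm (L F - F : Space p β κ) p (expMeasure β κ) =
          eLpNorm (fun t => translate β (σ * s) f t - f t) p (expMeasure β κ) := by
        refine eLpNorm_congr_ae ?_
        filter_upwards [Lp.coeFn_sub (L F) F, hfm.coeFn_toLp,
          coeFn_translationSemigroup hσ hs' F,
          translate_congr (mul_mul_nonpos hσ hs') hfm.coeFn_toLp] with t h4 h5 h6 h7
        rw [h4, Pi.sub_apply, h6, h7, h5]
      rw [h3]
      exact (ENNReal.toReal_lt_toReal (h1.trans ENNReal.ofReal_lt_top).ne
        ENNReal.ofReal_ne_top).2 h1 |>.trans_eq (ENNReal.toReal_ofReal (by positivity))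
    have h8 : ‖L (g - F)‖ ≤ ‖g - F‖ := by
      simpa using L.le_of_opNorm_le (hle s hs') (g - F)
    have h9 : L g - g = L (g - F) + (L F - F) - (g - F) := by
      rw [map_sub]
      abel
    rw [dist_eq_norm, h9]
    calc ‖L (g - F) + (L F - F) - (g - F)‖ ≤ ‖L (g - F)‖ + ‖L F - F‖ + ‖g - F‖ :=
          (norm_sub_le _ _).trans (add_le_add_left (norm_add_le _ _) _)
      _ < ε := by linarith

end

/-! ### Averages of translates are convolutions -/

section

variable {α : Type*} [MeasurableSpace α] {μ : Measure α} {p : ENNReal} [Fact (1 ≤ p)]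

theorem integrableOn_of_memLp {f : α → ℂ} (hf : MemLp f p μ) {E : Set α} (hE : μ E < ⊤) :
    IntegrableOn f E μ := by
  have : IsFiniteMeasure (μ.restrict E) := ⟨by simpa using hE⟩
  exact (hf.restrict E).integrable Fact.out

/-- Hölder's inequality on a set of finite measure, with an unspecified constant. -/
theorem exists_setIntegral_norm_le {E : Set α} (hE : μ E < ⊤) :
    ∃ C : ℝ, 0 ≤ C ∧ ∀ f : Lp ℂ p μ, ∫ t in E, ‖f t‖ ∂μ ≤ C * ‖f‖ := by
  have : IsFiniteMeasure (μ.restrict E) := ⟨by simpa using hE⟩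
  set c : ENNReal := (μ.restrict E) univ ^ (1 / (1 : ENNReal).toReal - 1 / p.toReal) with hc
  have hp1 : (1 : ENNReal) ≤ p := Fact.out
  have hexp : 0 ≤ 1 / (1 : ENNReal).toReal - 1 / p.toReal := by
    rcases eq_or_ne p ⊤ with rfl | hp
    · simp
    · have : 1 ≤ p.toReal := by
        rw [← ENNReal.toReal_one]
        exact (ENNReal.toReal_le_toReal ENNReal.one_ne_top hp).2 hp1
      simpa using inv_le_one_of_one_le₀ this
  have hct : c ≠ ⊤ := ENNReal.rpow_ne_top_of_nonneg hexp (measure_ne_top _ _)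
  refine ⟨c.toReal, ENNReal.toReal_nonneg, fun f => ?_⟩
  have h1 := eLpNorm_le_eLpNorm_mul_rpow_measure_univ hp1 (Lp.memLp f).1.restrict
    (μ := μ.restrict E)
  have h2 : eLpNorm f 1 (μ.restrict E) ≤ c * eLpNorm f p μ := by
    rw [mul_comm]
    refine h1.trans ?_
    gcongr
    exact Measure.restrict_le_self
  rw [integral_norm_eq_lintegral_enorm (Lp.memLp f).1.restrict, Lp.norm_def, ← ENNReal.toReal_mul,
    ← eLpNorm_one_eq_lintegral_enorm]
  exact ENNReal.toReal_mono (ENNReal.mul_ne_top hct (Lp.memLp f).2.ne) h2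

/-- Integration over a set of finite measure is a continuous functional on `L^p`. -/
theorem exists_clm_setIntegral (p : ENNReal) [Fact (1 ≤ p)] {E : Set α} (hE : μ E < ⊤) :
    ∃ L : Lp ℂ p μ →L[ℂ] ℂ, ∀ f, L f = ∫ t in E, f t ∂μ := by
  obtain ⟨C, -, hC⟩ := exists_setIntegral_norm_le (p := p) hE
  have hint : ∀ f : Lp ℂ p μ, IntegrableOn f E μ := fun f => integrableOn_of_memLp (Lp.memLp f) hE
  refine ⟨LinearMap.mkContinuous
    { toFun := fun f => ∫ t in E, f t ∂μ
      map_add' := fun f g => by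
        rw [← integral_add (hint f) (hint g)]
        exact integral_congr_ae (ae_restrict_of_ae (Lp.coeFn_add f g))
      map_smul' := fun c f => by
        rw [RingHom.id_apply, ← integral_smul]
        exact integral_congr_ae (ae_restrict_of_ae (Lp.coeFn_smul c f)) }
    C fun f => (norm_integral_le_integral_norm _).trans (hC f), fun f => rfl⟩

end

section

variable {β : EReal} {κ σ : ℝ} {p : ENNReal} [Fact (1 ≤ p)]

/-- The average `∫_0^∞ k(s) S(s) g ds` in `L^p` of translates is given pointwise by the
corresponding scalar integrals, which converge absolutely almost everywhere. -/
theorem ae_laplace_translationSemigroup (hp : p ≠ ⊤) (hσ : κ * σ ≤ 0) {k : ℝ → ℝ}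
    (hk : IntegrableOn k (Ioi 0)) (g : Space p β κ) :
    ∀ᵐ t ∂(expMeasure β κ),
      IntegrableOn (fun s => (k s : ℂ) * translate β (σ * s) g t) (Ioi 0) ∧
      (isContractionSemigroup_translationSemigroup hp hσ).laplace hk g t =
        ∫ s in Ioi (0 : ℝ), (k s : ℂ) * translate β (σ * s) g t := by
  set μ := expMeasure β κ with hμ
  set hS := isContractionSemigroup_translationSemigroup (β := β) hp hσ
  set S := translationSemigroup p β hσ
  set Φ : ℝ → ℝ → ℂ := fun s t => (k s : ℂ) * translate β (σ * s) g t with hΦ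
  have hkC : AEStronglyMeasurable (fun s => (k s : ℂ)) (volume.restrict (Ioi 0)) :=
    Complex.continuous_ofReal.comp_aestronglyMeasurable hk.aestronglyMeasurable
  have hmeas : ∀ E : Set ℝ, AEStronglyMeasurable (Function.uncurry Φ)
      ((volume.restrict (Ioi 0)).prod (μ.restrict E)) := by
    intro E
    refine hkC.comp_fst.mul ?_
    have h1 : StronglyMeasurable ((interval β).indicator (g : ℝ → ℂ)) :=
      (Lp.stronglyMeasurable g).indicator (measurableSet_interval β)
    exact (h1.comp_measurable (g := fun x : ℝ × ℝ => x.2 - σ * x.1)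
      (by fun_prop)).aestronglyMeasurable
  have hint : ∀ E : Set ℝ, μ E < ⊤ → Integrable (Function.uncurry Φ)
      ((volume.restrict (Ioi 0)).prod (μ.restrict E)) := by
    intro E hE
    obtain ⟨C, hC0, hC⟩ := exists_setIntegral_norm_le (p := p) hE
    have : IsFiniteMeasure (μ.restrict E) := ⟨by simpa using hE⟩
    refine (integrable_prod_iff (hmeas E)).2 ⟨?_, ?_⟩
    · filter_upwards [self_mem_ae_restrict measurableSet_Ioi] with s hs
      exact Integrable.const_mul (integrableOn_of_memLp
        (memLp_translate (mul_mul_nonpos hσ (le_of_lt hs)) (Lp.memLp g)) hE) (k s : ℂ)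
    · refine Integrable.mono' (hk.norm.mul_const (C * ‖g‖))
        (hmeas E).norm.integral_prod_right' ?_
      filter_upwards [self_mem_ae_restrict measurableSet_Ioi] with s hs
      have hs' : (0 : ℝ) ≤ s := le_of_lt hs
      rw [Real.norm_of_nonneg (integral_nonneg fun _ => norm_nonneg _)]
      simp only [Function.uncurry, hΦ, norm_mul, Complex.norm_real]
      rw [integral_const_mul]
      gcongr
      have h2 : ∫ t in E, ‖translate β (σ * s) g t‖ ∂μ = ∫ t in E, ‖S s g t‖ ∂μ := by
        refine integral_congr_ae (ae_restrict_of_ae ?_)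
        filter_upwards [coeFn_translationSemigroup hσ hs' g] with t ht
        rw [ht]
      rw [h2]
      refine (hC _).trans ?_
      gcongr
      exact hS.norm_apply_le hs' g
  have hE1 : ∀ E : Set ℝ, μ E < ⊤ → IntegrableOn (fun t => ∫ s in Ioi (0 : ℝ), Φ s t) E μ :=
    fun E hE => (hint E hE).integral_prod_right
  -- Both sides have the same integrals over sets of finite measure: integration over such a set is
  -- a continuous functional, hence commutes with the Bochner integral.
  have hae : (hS.laplace hk g : ℝ → ℂ) =ᵐ[μ] fun t => ∫ s in Ioi (0 : ℝ), Φ s t := by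
    refine ae_eq_of_forall_setIntegral_eq_of_sigmaFinite
      (fun E _ hE => integrableOn_of_memLp (Lp.memLp _) hE) (fun E _ hE => hE1 E hE) ?_
    intro E _ hE
    obtain ⟨L, hL⟩ : ∃ L : Space p β κ →L[ℂ] ℂ, ∀ f : Space p β κ, L f = ∫ t in E, f t ∂μ :=
      exists_clm_setIntegral p hE
    rw [← hL, hS.laplace_apply]
    refine (L.integral_comp_comm (hS.integrableOn hk g)).symm.trans ?_
    rw [integral_integral_swap (f := fun t s => Φ s t) (hint E hE).swap]
    refine setIntegral_congr_fun measurableSet_Ioi fun s hs => ?_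
    refine (L.map_smul (k s : ℂ) (S s g)).trans ?_
    simp only [hL, smul_eq_mul, hΦ]
    rw [integral_const_mul]
    congr 1
    exact integral_congr_ae (ae_restrict_of_ae (coeFn_translationSemigroup hσ (le_of_lt hs) g))
  have hae2 : ∀ᵐ t ∂μ, IntegrableOn (fun s => Φ s t) (Ioi 0) :=
    ae_of_forall_measure_lt_top_ae_restrict _ fun E _ hE => (hint E hE).prod_left_ae
  filter_upwards [hae, hae2] with t h1 h2 using ⟨h2, h1⟩

end

section ChangeOfVariables

variable {β : EReal} {t : ℝ}

theorem Iio_inter_interval (ht : t ∈ interval β) : Iio t ∩ interval β = Ioo 0 t := by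
  ext y
  refine ⟨fun h => ⟨h.2.1, h.1⟩, fun h => ⟨h.2, h.1, ?_⟩⟩
  exact (EReal.coe_lt_coe_iff.2 h.2).trans ht.2

theorem Ioi_inter_interval (ht : t ∈ interval β) :
    Ioi t ∩ interval β = {y : ℝ | t < y ∧ (y : EReal) < β} := by
  ext y
  exact ⟨fun h => ⟨h.1, h.2.2⟩, fun h => ⟨h.1, ht.1.trans h.1, h.2⟩⟩

/-- The substitution `y = t - s`, for convergence and for the value of the integral. -/
theorem integrableOn_integral_right_translate (ht : t ∈ interval β) (K : ℝ → ℝ) (g : ℝ → ℂ) :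
    (IntegrableOn (fun s => (K s : ℂ) * translate β (1 * s) g t) (Ioi 0) ↔
      IntegrableOn (fun y => (K (t - y) : ℂ) * g y) (Ioo 0 t)) ∧
    ∫ s in Ioi (0 : ℝ), (K s : ℂ) * translate β (1 * s) g t =
      ∫ y in Ioo 0 t, (K (t - y) : ℂ) * g y := by
  set G : ℝ → ℂ := fun y => (interval β).indicator (fun y => (K (t - y) : ℂ) * g y) y with hG
  have hmp := Measure.measurePreserving_sub_left volume t
  have hemb : MeasurableEmbedding fun s : ℝ => t - s := measurableEmbedding_subLeft t
  have hpre : (fun s : ℝ => t - s) ⁻¹' Iio t = Ioi 0 := by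
    ext s
    simp
  have hfun : (fun s => (K s : ℂ) * translate β (1 * s) g t) = G ∘ fun s => t - s := by
    ext s
    simp only [hG, Function.comp_apply, translate, one_mul]
    by_cases h : t - s ∈ interval β
    · simp only [indicator_of_mem h, sub_sub_cancel]
    · simp only [indicator_of_notMem h, mul_zero]
  rw [hfun, ← Iio_inter_interval ht, ← hpre, hmp.integrableOn_comp_preimage hemb, hG]
  refine ⟨?_, ?_⟩
  · rw [IntegrableOn, integrable_indicator_iff (measurableSet_interval β), IntegrableOn,
      Measure.restrict_restrict (measurableSet_interval β), inter_comm]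
    rfl
  · rw [inter_comm, ← Measure.restrict_restrict (measurableSet_interval β), ← integral_indicator
      (measurableSet_interval β)]
    exact hmp.setIntegral_preimage_emb hemb _ _

/-- The substitution `y = t + s`, for convergence and for the value of the integral. -/
theorem integrableOn_integral_left_translate (ht : t ∈ interval β) (K : ℝ → ℝ) (g : ℝ → ℂ) :
    (IntegrableOn (fun s => (K (-s) : ℂ) * translate β (-1 * s) g t) (Ioi 0) ↔
      IntegrableOn (fun y => (K (t - y) : ℂ) * g y) {y : ℝ | t < y ∧ (y : EReal) < β}) ∧
    ∫ s in Ioi (0 : ℝ), (K (-s) : ℂ) * translate β (-1 * s) g t =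
      ∫ y in {y : ℝ | t < y ∧ (y : EReal) < β}, (K (t - y) : ℂ) * g y := by
  set G : ℝ → ℂ := fun y => (interval β).indicator (fun y => (K (t - y) : ℂ) * g y) y with hG
  have hmp := measurePreserving_add_left volume t
  have hemb : MeasurableEmbedding fun s : ℝ => t + s := measurableEmbedding_addLeft t
  have hpre : (fun s : ℝ => t + s) ⁻¹' Ioi t = Ioi 0 := by
    ext s
    simp
  have hfun : (fun s => (K (-s) : ℂ) * translate β (-1 * s) g t) = G ∘ fun s => t + s := by
    ext s
    simp only [hG, Function.comp_apply, translate, neg_mul, one_mul, sub_neg_eq_add]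
    by_cases h : t + s ∈ interval β
    · simp only [indicator_of_mem h, sub_add_cancel_left]
    · simp only [indicator_of_notMem h, mul_zero]
  rw [hfun, ← Ioi_inter_interval ht, ← hpre, hmp.integrableOn_comp_preimage hemb, hG]
  refine ⟨?_, ?_⟩
  · rw [IntegrableOn, integrable_indicator_iff (measurableSet_interval β), IntegrableOn,
      Measure.restrict_restrict (measurableSet_interval β), inter_comm]
    rfl
  · rw [inter_comm, ← Measure.restrict_restrict (measurableSet_interval β), ← integral_indicator
      (measurableSet_interval β)]
    exact hmp.setIntegral_preimage_emb hemb _ _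

end ChangeOfVariables

/-! ### First order linear equations in integrated form -/

/-- Integration by parts against the primitive of an integrable function. -/
theorem integral_mul_primitive {a A b : ℝ → ℂ} {u v : ℝ} (huv : u ≤ v)
    (hA : ∀ x, HasDerivAt A (a x) x) (ha : Continuous a) (hb : IntervalIntegrable b volume u v) :
    ∫ r in u..v, a r * ∫ s in u..r, b s = ∫ s in u..v, (A v - A s) * b s := by
  have hb' : IntegrableOn b (Ioc u v) := (intervalIntegrable_iff_integrableOn_Ioc_of_le huv).1 hb
  have ha' : IntegrableOn a (Ioc u v) :=
    (intervalIntegrable_iff_integrableOn_Ioc_of_le huv).1 (ha.intervalIntegrable u v)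
  -- Fubini's theorem on the triangle `s ≤ r`.
  set F : ℝ → ℝ → ℂ := fun r s => {x : ℝ × ℝ | x.2 ≤ x.1}.indicator
    (fun x => a x.1 * b x.2) (r, s)
  have hF : Integrable (Function.uncurry F)
      ((volume.restrict (Ioc u v)).prod (volume.restrict (Ioc u v))) :=
    (Integrable.mul_prod ha' hb').indicator (measurableSet_le measurable_snd measurable_fst)
  have h1 : ∀ r ∈ Ioc u v, ∫ s in Ioc u v, F r s = a r * ∫ s in u..r, b s := by
    intro r hr
    have hFr : F r = (Iic r).indicator fun s => a r * b s := rfl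
    have hset : Ioc u v ∩ Iic r = Ioc u r := by
      rw [Ioc_inter_Iic, min_eq_right hr.2]
    rw [hFr, setIntegral_indicator measurableSet_Iic, hset, integral_const_mul,
      intervalIntegral.integral_of_le hr.1.le]
  have h2 : ∀ s ∈ Ioc u v, ∫ r in Ioc u v, F r s = (A v - A s) * b s := by
    intro s hs
    have hFs : (fun r => F r s) = (Ici s).indicator fun r => a r * b s := rfl
    have hset : Ioc u v ∩ Ici s = Icc s v := by
      ext r
      exact ⟨fun h => ⟨h.2, h.1.2⟩, fun h => ⟨⟨hs.1.trans_le h.1, h.2⟩, h.1⟩⟩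
    rw [hFs, setIntegral_indicator measurableSet_Ici, hset, integral_mul_const,
      integral_Icc_eq_integral_Ioc, ← intervalIntegral.integral_of_le hs.2,
      intervalIntegral.integral_eq_sub_of_hasDerivAt (fun x _ => hA x)
        (ha.intervalIntegrable s v)]
  rw [intervalIntegral.integral_of_le huv, intervalIntegral.integral_of_le huv,
    ← setIntegral_congr_fun measurableSet_Ioc h1, integral_integral_swap hF,
    setIntegral_congr_fun measurableSet_Ioc h2]

theorem hasDerivAt_ofReal_exp (c x : ℝ) :
    HasDerivAt (fun r : ℝ => (Real.exp (c * r) : ℂ)) (c * Real.exp (c * x) : ℂ) x := by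
  have h : HasDerivAt (fun r : ℝ => Real.exp (c * r)) (c * Real.exp (c * x)) x := by
    simpa [mul_comm] using ((hasDerivAt_id x).const_mul c).exp
  simpa using h.ofReal_comp

section

variable {u v : ℝ} {x : ℝ → ℂ}

theorem continuousOn_primitive_Icc (huv : u ≤ v) (hx : IntervalIntegrable x volume u v) :
    ContinuousOn (fun r => ∫ s in u..r, x s) (Icc u v) := by
  have := intervalIntegral.continuousOn_primitive_interval' hx left_mem_uIcc
  rwa [uIcc_of_le huv] at this

/-- The integrating factor `e^{c r}`: with `f(r) = f₀ + ∫_u^r x` the function `e^{c r} (c f + x)` is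
the derivative of `e^{c r} f`. -/
theorem integral_exp_mul_primitive (huv : u ≤ v) (hx : IntervalIntegrable x volume u v)
    (c : ℝ) (f₀ : ℂ) :
    ∫ r in u..v, (Real.exp (c * r) : ℂ) * (c * (f₀ + ∫ s in u..r, x s) + x r) =
      Real.exp (c * v) * (f₀ + ∫ s in u..v, x s) - Real.exp (c * u) * f₀ := by
  set e : ℝ → ℂ := fun r => (Real.exp (c * r) : ℂ)
  have he : Continuous e := by fun_prop
  have hP := continuousOn_primitive_Icc huv hx
  rw [← uIcc_of_le huv] at hP
  have hi1 : IntervalIntegrable (fun r => (c * e r) * f₀) volume u v :=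
    Continuous.intervalIntegrable (by fun_prop) u v
  have hi2 : IntervalIntegrable (fun r => (c * e r) * ∫ s in u..r, x s) volume u v :=
    ContinuousOn.intervalIntegrable (ContinuousOn.mul (by fun_prop) hP)
  have hi3 : IntervalIntegrable (fun r => e r * x r) volume u v :=
    hx.continuousOn_mul he.continuousOn
  have hi4 : IntervalIntegrable (fun r => e v * x r) volume u v := hx.const_mul _
  have h1 : ∀ r, e r * (c * (f₀ + ∫ s in u..r, x s) + x r) =
      (c * e r) * f₀ + (c * e r) * (∫ s in u..r, x s) + e r * x r := fun r => by ring
  have h2 : ∫ r in u..v, (c * e r) * ∫ s in u..r, x s =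
      e v * (∫ s in u..v, x s) - ∫ s in u..v, e s * x s := by
    rw [integral_mul_primitive huv (hasDerivAt_ofReal_exp c) (by fun_prop) hx]
    simp only [sub_mul]
    rw [intervalIntegral.integral_sub hi4 hi3, intervalIntegral.integral_const_mul]
  have h3 : ∫ r in u..v, (c * e r) * f₀ = (e v - e u) * f₀ := by
    rw [intervalIntegral.integral_mul_const, intervalIntegral.integral_eq_sub_of_hasDerivAt
      (fun r _ => hasDerivAt_ofReal_exp c r) (Continuous.intervalIntegrable (by fun_prop) u v)]
  refine (intervalIntegral.integral_congr fun r _ => h1 r).trans ?_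
  change _ = e v * _ - e u * _
  rw [intervalIntegral.integral_add (hi1.add hi2) hi3, intervalIntegral.integral_add hi1 hi2, h2,
    h3]
  ring

/-- The function `φ(r) = e^{-c r} (Φ + ∫_u^r c e^{c s} y(s) ds)` solves `φ' = c (y - φ)`, in
integrated form. -/
theorem integral_sub_exp_mul_primitive (huv : u ≤ v) {y φ : ℝ → ℂ}
    (hy : IntervalIntegrable y volume u v) (c : ℝ) (Φ : ℂ)
    (hφ : ∀ r ∈ Icc u v,
      φ r = Real.exp (-c * r) * (Φ + ∫ s in u..r, (c * Real.exp (c * s) : ℂ) * y s)) :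
    IntervalIntegrable φ volume u v ∧ ∫ r in u..v, (c : ℂ) * (y r - φ r) = φ v - φ u := by
  have hb : IntervalIntegrable (fun s => (c * Real.exp (c * s) : ℂ) * y s) volume u v :=
    hy.continuousOn_mul (Continuous.continuousOn (by fun_prop))
  set b : ℝ → ℂ := fun s => (c * Real.exp (c * s) : ℂ) * y s
  set e : ℝ → ℂ := fun r => (Real.exp (-c * r) : ℂ) with he_def
  have he : Continuous e := by fun_prop
  have hP := continuousOn_primitive_Icc huv hb
  have hφc : ContinuousOn φ (Icc u v) :=
    (he.continuousOn.mul (continuousOn_const.add hP)).congr hφ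
  rw [← uIcc_of_le huv] at hφc hP
  have hφi := hφc.intervalIntegrable (μ := volume)
  refine ⟨hφi, ?_⟩
  have hi1 : IntervalIntegrable (fun r => (c * e r) * Φ) volume u v :=
    Continuous.intervalIntegrable (by fun_prop) u v
  have hi2 : IntervalIntegrable (fun r => (c * e r) * ∫ s in u..r, b s) volume u v :=
    ContinuousOn.intervalIntegrable (ContinuousOn.mul (by fun_prop) hP)
  have hd : ∀ r, HasDerivAt (fun r => -e r) (c * e r) r := fun r => by
    have := (hasDerivAt_ofReal_exp (-c) r).fun_neg
    rwa [Complex.ofReal_neg, neg_mul, neg_neg] at this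
  have h1 : ∫ r in u..v, (c * e r) * ∫ s in u..r, b s =
      c * (∫ s in u..v, y s) - e v * ∫ s in u..v, b s := by
    rw [integral_mul_primitive huv hd (by fun_prop) hb]
    have h2 : ∀ s, (-e v - -e s) * b s = c * y s - e v * b s := fun s => by
      have h3 : e s * (Real.exp (c * s) : ℂ) = 1 := by
        rw [he_def, ← Complex.ofReal_mul, ← Real.exp_add]
        simp
      calc (-e v - -e s) * b s = c * (e s * (Real.exp (c * s) : ℂ)) * y s - e v * b s := by
            simp only [b]
            ring
        _ = _ := by rw [h3, mul_one]
    simp only [h2]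
    rw [intervalIntegral.integral_sub (hy.const_mul _) (hb.const_mul _),
      intervalIntegral.integral_const_mul, intervalIntegral.integral_const_mul]
  have h4 : ∫ r in u..v, (c * e r) * Φ = (e u - e v) * Φ := by
    rw [intervalIntegral.integral_mul_const, intervalIntegral.integral_eq_sub_of_hasDerivAt
      (fun r _ => hd r) (Continuous.intervalIntegrable (by fun_prop) u v)]
    ring
  have h5 : ∫ r in u..v, (c : ℂ) * φ r =
      (e u - e v) * Φ + (c * (∫ s in u..v, y s) - e v * ∫ s in u..v, b s) := by
    rw [← h4, ← h1, ← intervalIntegral.integral_add hi1 hi2]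
    refine intervalIntegral.integral_congr fun r hr => ?_
    rw [uIcc_of_le huv] at hr
    simp only [hφ r hr]
    ring
  have h6 : φ u = e u * Φ := by
    rw [hφ u (left_mem_Icc.2 huv), intervalIntegral.integral_same, add_zero]
  simp only [mul_sub]
  rw [intervalIntegral.integral_sub (hy.const_mul _) (hφi.const_mul _), h5, h6,
    hφ v (right_mem_Icc.2 huv), intervalIntegral.integral_const_mul]
  ring

end

/-! ### The resolvents of the integration operators -/

/-- Stated through the graph of `J`: the operator `δ⁻¹ (1 - V δ)` is the inverse of `J + δ` as soon
as `V δ (J + δ) = J` on the domain of `J` and `J δ⁻¹ (1 - V δ) = V δ` everywhere. -/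
theorem IsContractionSemigroup.isBoundedInverse_yosida {X : Type*} [NormedAddCommGroup X]
    [NormedSpace ℂ X] {S : ℝ → X →L[ℂ] X} (hS : IsContractionSemigroup S) {J : X →ₗ.[ℂ] X} {δ : ℝ}
    (hδ : 0 < δ) (h1 : ∀ x f, (x, f) ∈ J.graph → hS.average hδ (f + (δ : ℂ) • x) = f)
    (h2 : ∀ y, (hS.yosida hδ y, hS.average hδ y) ∈ J.graph) :
    IsBoundedInverse (shift J δ) (hS.yosida hδ) := by
  have hδ' : (δ : ℂ) ≠ 0 := Complex.ofReal_ne_zero.2 hδ.ne'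
  have hB : ∀ y, hS.yosida hδ y = (δ : ℂ)⁻¹ • (y - hS.average hδ y) := fun y => rfl
  refine ⟨fun x => ?_, fun y => ?_⟩
  · have h3 : shift J δ x = J x + (δ : ℂ) • (x : X) := rfl
    rw [hB, h3, h1 x (J x) (J.mem_graph x), add_sub_cancel_left, inv_smul_smul₀ hδ']
  · obtain ⟨x, hx1, hx2⟩ := (LinearPMap.mem_graph_iff J).1 (h2 y)
    simp only at hx1 hx2
    refine ⟨hx1 ▸ x.2, ?_⟩
    have h4 : (⟨hS.yosida hδ y, hx1 ▸ x.2⟩ : J.domain) = x := Subtype.ext hx1.symm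
    change J ⟨hS.yosida hδ y, _⟩ + (δ : ℂ) • hS.yosida hδ y = y
    rw [h4, hx2, hB, smul_inv_smul₀ hδ', add_sub_cancel]

section

variable {β : EReal} {κ : ℝ} {p : ENNReal} [Fact (1 ≤ p)]

/-- The pointwise formula for averages of right translates. -/
theorem ae_laplace_right (hp : p ≠ ⊤) (hσ : κ * 1 ≤ 0) {k : ℝ → ℝ}
    (hk : IntegrableOn k (Ioi 0)) (g : Space p β κ) :
    ∀ᵐ t : ℝ, t ∈ interval β →
      IntegrableOn (fun y => (k (t - y) : ℂ) * g y) (Ioo 0 t) ∧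
      ∫ y in Ioo 0 t, (k (t - y) : ℂ) * g y =
        (isContractionSemigroup_translationSemigroup hp hσ).laplace hk g t := by
  filter_upwards [ae_expMeasure_iff.1 (ae_laplace_translationSemigroup hp hσ hk g)] with t h ht
  have h1 := integrableOn_integral_right_translate ht k g
  exact ⟨h1.1.1 (h ht).1, by rw [(h ht).2, h1.2]⟩

/-- The pointwise formula for averages of left translates. -/
theorem ae_laplace_left (hp : p ≠ ⊤) (hσ : κ * (-1) ≤ 0) {k : ℝ → ℝ}
    (hk : IntegrableOn (fun s => k (-s)) (Ioi 0)) (g : Space p β κ) :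
    ∀ᵐ t : ℝ, t ∈ interval β →
      IntegrableOn (fun y => (k (t - y) : ℂ) * g y) {y : ℝ | t < y ∧ (y : EReal) < β} ∧
      ∫ y in {y : ℝ | t < y ∧ (y : EReal) < β}, (k (t - y) : ℂ) * g y =
        (isContractionSemigroup_translationSemigroup hp hσ).laplace hk g t := by
  filter_upwards [ae_expMeasure_iff.1 (ae_laplace_translationSemigroup hp hσ hk g)] with t h ht
  have h1 := integrableOn_integral_left_translate ht k g
  exact ⟨h1.1.1 (h ht).1, by rw [(h ht).2, h1.2]⟩

theorem ofReal_expDensity_sub (δ t y : ℝ) :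
    (expDensity δ (t - y) : ℂ) =
      (Real.exp (-δ⁻¹ * t) : ℂ) * ((δ⁻¹ : ℝ) * Real.exp (δ⁻¹ * y) : ℂ) := by
  rw [expDensity, mul_left_comm, ← Complex.ofReal_mul, ← Complex.ofReal_mul, ← Real.exp_add]
  push_cast
  congr 2
  ring

theorem ofReal_expDensity_sub' (δ t y : ℝ) :
    (expDensity δ (y - t) : ℂ) =
      -((Real.exp (δ⁻¹ * t) : ℂ) * ((-δ⁻¹ : ℝ) * Real.exp (-δ⁻¹ * y) : ℂ)) := by
  rw [expDensity, mul_left_comm, ← Complex.ofReal_mul, ← Complex.ofReal_mul, ← Complex.ofReal_neg,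
    neg_mul (δ⁻¹) (Real.exp _ * _), neg_neg, ← Real.exp_add]
  congr 3
  ring

/-- The identity `V δ (𝓙⁺ + δ) x = 𝓙⁺ x`: the integrating factor `e^{y/δ}` turns the convolution
into the integral of a derivative. -/
theorem average_of_hasJPlus (hp : p ≠ ⊤) (hσ : κ * 1 ≤ 0) {δ : ℝ} (hδ : 0 < δ)
    {x f : Space p β κ} (h : HasJPlus β x f) :
    (isContractionSemigroup_translationSemigroup hp hσ).average hδ (f + (δ : ℂ) • x) = f := by
  refine Lp.ext (ae_expMeasure_iff.2 ?_)
  filter_upwards [ae_laplace_right hp hσ (integrableOn_expDensity hδ) (f + (δ : ℂ) • x), h]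
    with t h1 h2 ht
  rw [IsContractionSemigroup.average, ← (h1 ht).2]
  obtain ⟨hxi, hft⟩ := h2 ht
  have hg : ∀ᵐ y : ℝ, y ∈ Ioo 0 t →
      (expDensity δ (t - y) : ℂ) * (f + (δ : ℂ) • x : Space p β κ) y =
      (Real.exp (-δ⁻¹ * t) : ℂ) * ((Real.exp (δ⁻¹ * y) : ℂ) *
        ((δ⁻¹ : ℝ) * (0 + ∫ s in (0 : ℝ)..y, x s) + x y)) := by
    filter_upwards [ae_expMeasure_iff.1 (Lp.coeFn_add f ((δ : ℂ) • x)),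
      ae_expMeasure_iff.1 (Lp.coeFn_smul (δ : ℂ) x), h] with y h3 h4 h5 hy
    have hyI : y ∈ interval β := ⟨hy.1, (EReal.coe_lt_coe_iff.2 hy.2).trans ht.2⟩
    have hδ' : (δ : ℂ) ≠ 0 := Complex.ofReal_ne_zero.2 hδ.ne'
    rw [h3 hyI, Pi.add_apply, h4 hyI, Pi.smul_apply, (h5 hyI).2, smul_eq_mul, zero_add,
      ofReal_expDensity_sub, Complex.ofReal_inv]
    field_simp
  rw [setIntegral_congr_ae measurableSet_Ioo hg, ← integral_Ioc_eq_integral_Ioo,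
    ← intervalIntegral.integral_of_le ht.1.le, intervalIntegral.integral_const_mul,
    integral_exp_mul_primitive ht.1.le hxi, hft, zero_add, mul_zero, sub_zero, ← mul_assoc,
    ← Complex.ofReal_mul, ← Real.exp_add]
  simp

/-- The identity `𝓙⁺ δ⁻¹ (1 - V δ) y = V δ y`, the left hand side being defined. -/
theorem hasJPlus_yosida (hp : p ≠ ⊤) (hσ : κ * 1 ≤ 0) {δ : ℝ} (hδ : 0 < δ) (y : Space p β κ) :
    HasJPlus β ((isContractionSemigroup_translationSemigroup hp hσ).yosida hδ y)
      ((isContractionSemigroup_translationSemigroup hp hσ).average hδ y) := by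
  set hS := isContractionSemigroup_translationSemigroup (β := β) hp hσ
  set w : ℝ → ℂ := fun t => ∫ s in Ioo 0 t, (expDensity δ (t - s) : ℂ) * y s with hw
  have hV := ae_laplace_right hp hσ (integrableOn_expDensity hδ) y
  have hmain : HasJPlus β (fun t => ((δ⁻¹ : ℝ) : ℂ) * (y t - w t)) w := by
    filter_upwards [hV] with t h1 ht
    have hyi : IntervalIntegrable y volume 0 t := by
      -- The kernel is bounded away from zero on `[0, t]`.
      rw [intervalIntegrable_iff_integrableOn_Ioo_of_le ht.1.le,
        ← integrableOn_Icc_iff_integrableOn_Ioo]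
      have h2 := (integrableOn_Icc_iff_integrableOn_Ioo (f := _)).2 (h1 ht).1
      have h3 := h2.continuousOn_mul (g := fun s => ((expDensity δ (t - s))⁻¹ : ℂ)) ?_ isCompact_Icc
      · refine h3.congr_fun (fun s _ => ?_) measurableSet_Icc
        have : (expDensity δ (t - s) : ℂ) ≠ 0 := Complex.ofReal_ne_zero.2
          (mul_pos (inv_pos.2 hδ) (Real.exp_pos _)).ne'
        simp only
        rw [inv_mul_cancel_left₀ this]
      · refine ContinuousOn.inv₀ (Continuous.continuousOn ?_) fun s _ =>
          Complex.ofReal_ne_zero.2 (mul_pos (inv_pos.2 hδ) (Real.exp_pos _)).ne'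
        unfold expDensity
        fun_prop
    have hφ : ∀ r ∈ Icc 0 t, w r = Real.exp (-δ⁻¹ * r) *
        (0 + ∫ s in (0 : ℝ)..r, ((δ⁻¹ : ℝ) * Real.exp (δ⁻¹ * s) : ℂ) * y s) := by
      intro r hr
      rw [zero_add, ← intervalIntegral.integral_const_mul, intervalIntegral.integral_of_le hr.1,
        integral_Ioc_eq_integral_Ioo]
      simp only [hw, ofReal_expDensity_sub, mul_assoc]
    obtain ⟨hwi, heq⟩ := integral_sub_exp_mul_primitive ht.1.le hyi δ⁻¹ 0 hφ
    refine ⟨(hyi.sub hwi).const_mul _, ?_⟩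
    rw [heq, hφ 0 ⟨le_rfl, ht.1.le⟩]
    simp
  have hVw : ∀ᵐ t : ℝ, t ∈ interval β → hS.average hδ y t = w t := by
    filter_upwards [hV] with t h1 ht using (h1 ht).2.symm
  refine hmain.congr ?_ hVw
  filter_upwards [hVw, ae_expMeasure_iff.1 (Lp.coeFn_smul (δ : ℂ)⁻¹ (y - hS.average hδ y)),
    ae_expMeasure_iff.1 (Lp.coeFn_sub y (hS.average hδ y))] with t h1 h2 h3 ht
  change ((δ : ℂ)⁻¹ • (y - hS.average hδ y) : Space p β κ) t = _
  rw [h2 ht, Pi.smul_apply, h3 ht, Pi.sub_apply, h1 ht, Complex.ofReal_inv, smul_eq_mul]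

theorem isBoundedInverse_shift_JPlus (hp : p ≠ ⊤) (hσ : κ * 1 ≤ 0) {δ : ℝ} (hδ : 0 < δ) :
    IsBoundedInverse (shift (JPlus p β κ) δ)
      ((isContractionSemigroup_translationSemigroup hp hσ).yosida hδ) := by
  refine IsContractionSemigroup.isBoundedInverse_yosida _ hδ (fun x f hxf => ?_) fun y => ?_
  · rw [JPlus_graph] at hxf
    exact average_of_hasJPlus hp hσ hδ hxf
  · rw [JPlus_graph]
    exact hasJPlus_yosida hp hσ hδ y

end

/-! ### The resolvent of the integration towards the right endpoint -/

section

variable {β : EReal}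

theorem measurableSet_upper (β : EReal) (t : ℝ) :
    MeasurableSet {y : ℝ | t < y ∧ (y : EReal) < β} :=
  measurableSet_Ioi.inter (measurable_coe_real_ereal measurableSet_Iio)

theorem Ioc_subset_upper {t b : ℝ} (hb : (b : EReal) < β) :
    Ioc t b ⊆ {y : ℝ | t < y ∧ (y : EReal) < β} := fun _ hy =>
  ⟨hy.1, lt_of_le_of_lt (EReal.coe_le_coe_iff.2 hy.2) hb⟩

theorem setIntegral_upper_eq_add {E : Type*} [NormedAddCommGroup E] [NormedSpace ℝ E] {G : ℝ → E}
    {t b : ℝ} (htb : t ≤ b) (hb : (b : EReal) < β)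
    (hG : IntegrableOn G {y : ℝ | t < y ∧ (y : EReal) < β}) :
    ∫ y in {y : ℝ | t < y ∧ (y : EReal) < β}, G y =
      (∫ y in t..b, G y) + ∫ y in {y : ℝ | b < y ∧ (y : EReal) < β}, G y := by
  have hsub : {y : ℝ | b < y ∧ (y : EReal) < β} ⊆ {y : ℝ | t < y ∧ (y : EReal) < β} :=
    fun y hy => ⟨htb.trans_lt hy.1, hy.2⟩
  have hunion : {y : ℝ | t < y ∧ (y : EReal) < β} =
      Ioc t b ∪ {y : ℝ | b < y ∧ (y : EReal) < β} := by
    refine Subset.antisymm (fun y hy => ?_) (union_subset (Ioc_subset_upper hb) hsub)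
    rcases le_or_gt y b with h | h
    · exact Or.inl ⟨hy.1, h⟩
    · exact Or.inr ⟨h, hy.2⟩
  rw [hunion, setIntegral_union (disjoint_left.2 fun y h1 h2 => absurd h2.1 (not_lt.2 h1.2))
    (measurableSet_upper β b) (hG.mono_set (Ioc_subset_upper hb)) (hG.mono_set hsub),
    intervalIntegral.integral_of_le htb]

/-- An integral over `(t, β)` is the limit of the integrals over `(t, b)` as `b` increases to
`β`. -/
theorem tendsto_intervalIntegral_upper {E : Type*} [NormedAddCommGroup E] [NormedSpace ℝ E]
    {G : ℝ → E} {t : ℝ} (ht : (t : EReal) < β)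
    (hG : IntegrableOn G {y : ℝ | t < y ∧ (y : EReal) < β}) :
    Tendsto (fun b : ℝ => ∫ y in t..b, G y) (comap (fun b : ℝ => (b : EReal)) (𝓝[<] β))
      (𝓝 (∫ y in {y : ℝ | t < y ∧ (y : EReal) < β}, G y)) := by
  have h1 : Tendsto (fun b : ℝ => ∫ y in {y : ℝ | t < y ∧ (y : EReal) < β},
      (Iic b).indicator G y) (comap (fun b : ℝ => (b : EReal)) (𝓝[<] β))
      (𝓝 (∫ y in {y : ℝ | t < y ∧ (y : EReal) < β}, G y)) := by
    refine tendsto_integral_filter_of_dominated_convergence (fun y => ‖G y‖) ?_ ?_ hG.norm ?_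
    · exact Eventually.of_forall fun b => hG.aestronglyMeasurable.indicator measurableSet_Iic
    · exact Eventually.of_forall fun b => Eventually.of_forall fun y =>
        norm_indicator_le_norm_self _ _
    · filter_upwards [self_mem_ae_restrict (measurableSet_upper β t)] with y hy
      refine tendsto_const_nhds.congr' ?_
      filter_upwards [comap_le_Ioo hy.2] with b hb
      rw [indicator_of_mem (mem_Iic.2 hb.1.le)]
  refine h1.congr' ?_
  filter_upwards [comap_le_Ioo ht] with b hb
  rw [setIntegral_indicator measurableSet_Iic, intervalIntegral.integral_of_le hb.1.le]
  congr 2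
  ext y
  exact ⟨fun h => ⟨h.1.1, h.2⟩, fun h => ⟨Ioc_subset_upper hb.2 h, h.2⟩⟩

theorem tendsto_setIntegral_upper_zero {G : ℝ → ℝ} {t : ℝ} (ht : (t : EReal) < β)
    (hG : IntegrableOn G {y : ℝ | t < y ∧ (y : EReal) < β}) :
    Tendsto (fun b : ℝ => ∫ y in {y : ℝ | b < y ∧ (y : EReal) < β}, G y)
      (comap (fun b : ℝ => (b : EReal)) (𝓝[<] β)) (𝓝 0) := by
  have h1 := (tendsto_intervalIntegral_upper ht hG).const_sub
    (∫ y in {y : ℝ | t < y ∧ (y : EReal) < β}, G y)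
  rw [sub_self] at h1
  refine h1.congr' ?_
  filter_upwards [comap_le_Ioo ht] with b hb
  rw [setIntegral_upper_eq_add hb.1.le hb.2 hG, add_sub_cancel_left]

end

section

variable {β : EReal} {κ : ℝ} {p : ENNReal} [Fact (1 ≤ p)]

theorem restrict_interval_le_expMeasure (hκ : 0 ≤ κ) :
    volume.restrict (interval β) ≤ expMeasure β κ := by
  refine Measure.le_iff.2 fun A hA => ?_
  rw [Measure.restrict_apply hA, expMeasure_apply β κ hA, ← setLIntegral_one]
  refine setLIntegral_mono' (hA.inter (measurableSet_interval β)) fun t ht => ?_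
  rw [ENNReal.one_le_ofReal]
  exact Real.one_le_exp (mul_nonneg hκ ht.2.1.le)

/-- Exponential averages over `(b, β)` of a function in `L^p` tend to zero as `b` increases
to `β`. -/
theorem tendsto_average_upper_zero (hβ : 0 < β) (hp : p ≠ ⊤) (hκ : 0 ≤ κ) {δ : ℝ} (hδ : 0 < δ)
    (g : Space p β κ) :
    Tendsto (fun b : ℝ => ∫ y in {y : ℝ | b < y ∧ (y : EReal) < β},
      (expDensity δ (y - b) : ℂ) * g y) (comap (fun b : ℝ => (b : EReal)) (𝓝[<] β)) (𝓝 0) := by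
  have hp0 : p ≠ 0 := (zero_lt_one.trans_le Fact.out).ne'
  have hp1 : 1 ≤ p.toReal := by
    rw [← ENNReal.toReal_one]
    exact (ENNReal.toReal_le_toReal ENNReal.one_ne_top hp).2 Fact.out
  have hG : IntegrableOn (fun y => ‖g y‖ ^ p.toReal) {y : ℝ | 0 < y ∧ (y : EReal) < β} :=
    ((Lp.memLp g).integrable_norm_rpow hp0 hp).mono_measure (restrict_interval_le_expMeasure hκ)
  have hβ' : ((0 : ℝ) : EReal) < β := by exact_mod_cast hβ
  have hlim := tendsto_setIntegral_upper_zero hβ' hG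
  refine Metric.tendsto_nhds.2 fun ε hε => ?_
  set η := ε / 2 with hη_def
  have hη : 0 < η := by positivity
  set C := δ⁻¹ * η ^ (1 - p.toReal) with hC_def
  have hC : 0 < C := by positivity
  filter_upwards [Metric.tendsto_nhds.1 hlim (η / C) (by positivity), comap_le_Ioo hβ'] with b h1 hb
  set D := {y : ℝ | b < y ∧ (y : EReal) < β} with hD
  have hDm : MeasurableSet D := measurableSet_upper β b
  have hGD : IntegrableOn (fun y => ‖g y‖ ^ p.toReal) D :=
    hG.mono_set fun y hy => ⟨hb.1.trans hy.1, hy.2⟩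
  rw [dist_zero_right, Real.norm_of_nonneg (integral_nonneg fun _ => by positivity),
    lt_div_iff₀ hC] at h1
  have hexp : IntegrableOn (fun y => expDensity δ (y - b)) (Ioi b) ∧
      ∫ y in Ioi b, expDensity δ (y - b) = 1 := by
    have hmp := measurePreserving_sub_right volume b
    have hemb : MeasurableEmbedding fun y : ℝ => y - b := measurableEmbedding_subRight b
    have hpre : (fun y : ℝ => y - b) ⁻¹' Ioi 0 = Ioi b := by
      ext y
      simp
    rw [← hpre]
    exact ⟨(hmp.integrableOn_comp_preimage hemb).2 (integrableOn_expDensity hδ),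
      (hmp.setIntegral_preimage_emb hemb _ _).trans (integral_expDensity hδ)⟩
  have hDsub : D ⊆ Ioi b := fun y hy => hy.1
  have hle : ∀ y ∈ D, ‖(expDensity δ (y - b) : ℂ) * g y‖ ≤
      expDensity δ (y - b) * η + C * ‖g y‖ ^ p.toReal := by
    intro y hy
    have hE0 := expDensity_nonneg hδ (y - b)
    have hE1 : expDensity δ (y - b) ≤ δ⁻¹ := by
      refine mul_le_of_le_one_right (inv_nonneg.2 hδ.le) (Real.exp_le_one_iff.2 ?_)
      have : 0 ≤ δ⁻¹ * (y - b) := mul_nonneg (inv_nonneg.2 hδ.le) (sub_nonneg.2 (le_of_lt hy.1))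
      linarith
    -- Small values of `g` are bounded by `η`, large ones by a multiple of `‖g‖ ^ p`; this replaces
    -- Hölder's inequality and covers `p = 1`.
    have hyoung : ‖g y‖ ≤ η + η ^ (1 - p.toReal) * ‖g y‖ ^ p.toReal := by
      rcases le_or_gt ‖g y‖ η with h | h
      · exact h.trans (le_add_of_nonneg_right (by positivity))
      · have h0 : 0 < ‖g y‖ := hη.trans h
        have h2 : ‖g y‖ ^ (1 - p.toReal) ≤ η ^ (1 - p.toReal) :=
          Real.rpow_le_rpow_of_nonpos hη h.le (by linarith)
        calc ‖g y‖ = ‖g y‖ ^ (1 - p.toReal) * ‖g y‖ ^ p.toReal := by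
              rw [← Real.rpow_add h0, sub_add_cancel, Real.rpow_one]
          _ ≤ η ^ (1 - p.toReal) * ‖g y‖ ^ p.toReal := by gcongr
          _ ≤ _ := le_add_of_nonneg_left hη.le
    rw [norm_mul, Complex.norm_real, Real.norm_of_nonneg hE0]
    calc expDensity δ (y - b) * ‖g y‖
        ≤ expDensity δ (y - b) * (η + η ^ (1 - p.toReal) * ‖g y‖ ^ p.toReal) := by gcongr
      _ = expDensity δ (y - b) * η +
          expDensity δ (y - b) * (η ^ (1 - p.toReal) * ‖g y‖ ^ p.toReal) := by ring
      _ ≤ expDensity δ (y - b) * η + δ⁻¹ * (η ^ (1 - p.toReal) * ‖g y‖ ^ p.toReal) := by gcongr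
      _ = _ := by rw [hC_def]; ring
  have hi1 : IntegrableOn (fun y => expDensity δ (y - b) * η) D :=
    Integrable.mul_const (hexp.1.mono_set hDsub) η
  have hi2 : IntegrableOn (fun y => C * ‖g y‖ ^ p.toReal) D := Integrable.const_mul hGD C
  have hmass : ∫ y in D, expDensity δ (y - b) ≤ 1 := by
    rw [← hexp.2]
    exact setIntegral_mono_set hexp.1 (Eventually.of_forall fun y => expDensity_nonneg hδ _)
      hDsub.eventuallyLE
  rw [dist_zero_right]
  calc ‖∫ y in D, (expDensity δ (y - b) : ℂ) * g y‖
      ≤ ∫ y in D, (expDensity δ (y - b) * η + C * ‖g y‖ ^ p.toReal) :=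
        norm_integral_le_of_norm_le (hi1.add hi2)
          ((ae_restrict_iff' hDm).2 (Eventually.of_forall hle))
    _ = (∫ y in D, expDensity δ (y - b)) * η + C * ∫ y in D, ‖g y‖ ^ p.toReal := by
        rw [integral_add hi1 hi2, integral_mul_const, integral_const_mul]
    _ ≤ 1 * η + C * ∫ y in D, ‖g y‖ ^ p.toReal := by gcongr
    _ < ε := by linarith

/-- The identity `V δ (𝓙⁻ + δ) x = 𝓙⁻ x`. On `(t, b)` the integrating factor leaves a boundary term
at `b`, which vanishes as `b` increases to `β`. -/
theorem average_of_hasJMinus (hp : p ≠ ⊤) (hσ : κ * (-1) ≤ 0) {δ : ℝ} (hδ : 0 < δ)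
    {x f : Space p β κ} (h : HasJMinus β x f) :
    (isContractionSemigroup_translationSemigroup hp hσ).average hδ (f + (δ : ℂ) • x) = f := by
  refine Lp.ext (ae_expMeasure_iff.2 ?_)
  have hk : IntegrableOn (fun s => expDensity δ (- -s)) (Ioi 0) := by
    simpa only [neg_neg] using integrableOn_expDensity hδ
  have hV := ae_laplace_left (k := fun s => expDensity δ (-s)) hp hσ hk (f + (δ : ℂ) • x)
  simp only [neg_neg, neg_sub] at hV
  filter_upwards [hV, h] with t h1 h2 ht
  rw [IsContractionSemigroup.average, ← (h1 ht).2]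
  obtain ⟨hxi, hft⟩ := h2 ht
  have hb : ∀ b : ℝ, t < b → (b : EReal) < β →
      ∫ y in t..b, (expDensity δ (y - t) : ℂ) * (f + (δ : ℂ) • x : Space p β κ) y =
        f t - Real.exp (-δ⁻¹ * (b - t)) * (f t - ∫ y in t..b, x y) := by
    intro b htb hbβ
    have hg : ∀ᵐ y : ℝ, y ∈ uIoc t b →
        (expDensity δ (y - t) : ℂ) * (f + (δ : ℂ) • x : Space p β κ) y =
        -(Real.exp (δ⁻¹ * t) : ℂ) * ((Real.exp (-δ⁻¹ * y) : ℂ) *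
          ((-δ⁻¹ : ℝ) * (f t + ∫ s in t..y, -x s) + -x y)) := by
      filter_upwards [ae_expMeasure_iff.1 (Lp.coeFn_add f ((δ : ℂ) • x)),
        ae_expMeasure_iff.1 (Lp.coeFn_smul (δ : ℂ) x), h] with y h3 h4 h5 hy
      rw [uIoc_of_le htb.le] at hy
      have hyβ : (y : EReal) < β := lt_of_le_of_lt (EReal.coe_le_coe_iff.2 hy.2) hbβ
      have hyI : y ∈ interval β := ⟨ht.1.trans hy.1, hyβ⟩
      have hδ' : (δ : ℂ) ≠ 0 := Complex.ofReal_ne_zero.2 hδ.ne'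
      -- The limits defining `f y` and `f t` differ by the integral over `(t, y)`.
      have h6 : f t = (∫ s in t..y, x s) + f y := by
        have := comap_neBot hyβ
        refine tendsto_nhds_unique hft (((h5 hyI).2.const_add (∫ s in t..y, x s)).congr' ?_)
        filter_upwards [comap_le_Ioo hyβ] with b' hb'
        exact intervalIntegral.integral_add_adjacent_intervals (hxi y hy.1 hyβ)
          ((h5 hyI).1 b' hb'.1 hb'.2)
      rw [h3 hyI, Pi.add_apply, h4 hyI, Pi.smul_apply, smul_eq_mul, intervalIntegral.integral_neg,
        h6, ofReal_expDensity_sub', Complex.ofReal_neg, Complex.ofReal_inv]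
      field_simp
      ring
    have hneg : IntervalIntegrable (fun s => -x s) volume t b := (hxi b htb hbβ).neg
    rw [intervalIntegral.integral_congr_ae hg, intervalIntegral.integral_const_mul,
      integral_exp_mul_primitive htb.le hneg, intervalIntegral.integral_neg]
    have e1 : (Real.exp (δ⁻¹ * t) : ℂ) * Real.exp (-δ⁻¹ * b) = Real.exp (-δ⁻¹ * (b - t)) := by
      rw [← Complex.ofReal_mul, ← Real.exp_add]
      ring_nf
    have e2 : (Real.exp (δ⁻¹ * t) : ℂ) * Real.exp (-δ⁻¹ * t) = 1 := by
      rw [← Complex.ofReal_mul, ← Real.exp_add]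
      simp
    linear_combination (-(f t - ∫ y in t..b, x y)) * e1 + f t * e2
  have := comap_neBot ht.2
  refine tendsto_nhds_unique (tendsto_intervalIntegral_upper ht.2 (h1 ht).1) ?_
  have hzero : Tendsto (fun b : ℝ => (Real.exp (-δ⁻¹ * (b - t)) : ℂ) * (f t - ∫ y in t..b, x y))
      (comap (fun b : ℝ => (b : EReal)) (𝓝[<] β)) (𝓝 0) := by
    have h7 : Tendsto (fun b : ℝ => ‖f t - ∫ y in t..b, x y‖)
        (comap (fun b : ℝ => (b : EReal)) (𝓝[<] β)) (𝓝 0) := by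
      have := (hft.const_sub (f t)).norm
      rwa [sub_self, norm_zero] at this
    refine squeeze_zero_norm' ?_ h7
    filter_upwards [comap_le_Ioo ht.2] with b hb'
    rw [norm_mul, Complex.norm_real, Real.norm_of_nonneg (Real.exp_pos _).le]
    refine mul_le_of_le_one_left (norm_nonneg _) (Real.exp_le_one_iff.2 ?_)
    have : 0 ≤ δ⁻¹ * (b - t) := mul_nonneg (inv_nonneg.2 hδ.le) (sub_nonneg.2 hb'.1.le)
    linarith
  have h8 := hzero.const_sub (f t)
  rw [sub_zero] at h8
  refine h8.congr' ?_
  filter_upwards [comap_le_Ioo ht.2] with b hb' using (hb b hb'.1 hb'.2).symm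

/-- The identity `𝓙⁻ δ⁻¹ (1 - V δ) y = V δ y`, the left hand side being defined. -/
theorem hasJMinus_yosida (hβ : 0 < β) (hp : p ≠ ⊤) (hσ : κ * (-1) ≤ 0) {δ : ℝ} (hδ : 0 < δ)
    (y : Space p β κ) :
    HasJMinus β ((isContractionSemigroup_translationSemigroup hp hσ).yosida hδ y)
      ((isContractionSemigroup_translationSemigroup hp hσ).average hδ y) := by
  have hκ : 0 ≤ κ := by linarith
  set hS := isContractionSemigroup_translationSemigroup (β := β) hp hσ
  set w : ℝ → ℂ := fun t => ∫ s in {s : ℝ | t < s ∧ (s : EReal) < β},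
    (expDensity δ (s - t) : ℂ) * y s with hw
  have hk : IntegrableOn (fun s => expDensity δ (- -s)) (Ioi 0) := by
    simpa only [neg_neg] using integrableOn_expDensity hδ
  have hV : ∀ᵐ t : ℝ, t ∈ interval β →
      IntegrableOn (fun s => (expDensity δ (s - t) : ℂ) * y s)
        {s : ℝ | t < s ∧ (s : EReal) < β} ∧ w t = hS.average hδ y t := by
    have := ae_laplace_left (k := fun s => expDensity δ (-s)) hp hσ hk y
    simp only [neg_neg, neg_sub] at this
    exact this
  have hw0 : Tendsto w (comap (fun b : ℝ => (b : EReal)) (𝓝[<] β)) (𝓝 0) :=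
    tendsto_average_upper_zero hβ hp hκ hδ y
  have hmain : HasJMinus β (fun t => ((δ⁻¹ : ℝ) : ℂ) * (y t - w t)) w := by
    filter_upwards [hV] with t h1 ht
    set h : ℝ → ℂ := fun s => ((-δ⁻¹ : ℝ) * Real.exp (-δ⁻¹ * s) : ℂ) * y s with hh
    have hexp0 : ∀ s, ((-δ⁻¹ : ℝ) * Real.exp (-δ⁻¹ * s) : ℂ) ≠ 0 := fun s =>
      mul_ne_zero (Complex.ofReal_ne_zero.2 (neg_ne_zero.2 (inv_ne_zero hδ.ne')))
        (Complex.ofReal_ne_zero.2 (Real.exp_pos _).ne')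
    have hker : ∀ r s, (expDensity δ (s - r) : ℂ) * y s = -(Real.exp (δ⁻¹ * r) : ℂ) * h s := by
      intro r s
      rw [ofReal_expDensity_sub', hh]
      ring
    have hhi : IntegrableOn h {s : ℝ | t < s ∧ (s : EReal) < β} := by
      have h2 := (h1 ht).1
      simp only [hker] at h2
      have h3 := Integrable.const_mul h2 (-(Real.exp (δ⁻¹ * t) : ℂ))⁻¹
      have h4 : -(Real.exp (δ⁻¹ * t) : ℂ) ≠ 0 :=
        neg_ne_zero.2 (Complex.ofReal_ne_zero.2 (Real.exp_pos _).ne')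
      simp only [inv_mul_cancel_left₀ h4] at h3
      exact h3
    have hyi : ∀ b : ℝ, t < b → (b : EReal) < β → IntervalIntegrable y volume t b := by
      intro b htb hb
      have h5 : IntervalIntegrable h volume t b :=
        (intervalIntegrable_iff_integrableOn_Ioc_of_le htb.le).2
          (hhi.mono_set (Ioc_subset_upper hb))
      have h6 := h5.continuousOn_mul
        (g := fun s => ((-δ⁻¹ : ℝ) * Real.exp (-δ⁻¹ * s) : ℂ)⁻¹)
        (ContinuousOn.inv₀ (Continuous.continuousOn (by fun_prop)) fun s _ => hexp0 s)
      refine h6.congr fun s _ => ?_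
      simp only [hh]
      rw [inv_mul_cancel_left₀ (hexp0 s)]
    have hφ : ∀ r, t ≤ r → (r : EReal) < β → w r = Real.exp (-(-δ⁻¹) * r) *
        (-(∫ s in {s : ℝ | t < s ∧ (s : EReal) < β}, h s) + ∫ s in t..r, h s) := by
      intro r htr hr
      rw [setIntegral_upper_eq_add htr hr hhi, neg_neg, hw]
      simp only [hker]
      rw [integral_const_mul]
      ring
    have hkey : ∀ b : ℝ, t < b → (b : EReal) < β →
        IntervalIntegrable (fun r => ((δ⁻¹ : ℝ) : ℂ) * (y r - w r)) volume t b ∧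
        ∫ r in t..b, ((δ⁻¹ : ℝ) : ℂ) * (y r - w r) = w t - w b := by
      intro b htb hb
      obtain ⟨hwi, heq⟩ := integral_sub_exp_mul_primitive htb.le (hyi b htb hb) (-δ⁻¹) _
        fun r hr => hφ r hr.1 (lt_of_le_of_lt (EReal.coe_le_coe_iff.2 hr.2) hb)
      refine ⟨((hyi b htb hb).sub hwi).const_mul _, ?_⟩
      rw [← neg_sub (w b), ← heq, ← intervalIntegral.integral_neg]
      simp
    refine ⟨fun b htb hb => (hkey b htb hb).1, ?_⟩
    have h7 := hw0.const_sub (w t)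
    rw [sub_zero] at h7
    refine h7.congr' ?_
    filter_upwards [comap_le_Ioo ht.2] with b hb using (hkey b hb.1 hb.2).2.symm
  have hVw : ∀ᵐ t : ℝ, t ∈ interval β → hS.average hδ y t = w t := by
    filter_upwards [hV] with t h1 ht using (h1 ht).2.symm
  refine hmain.congr ?_ hVw
  filter_upwards [hVw, ae_expMeasure_iff.1 (Lp.coeFn_smul (δ : ℂ)⁻¹ (y - hS.average hδ y)),
    ae_expMeasure_iff.1 (Lp.coeFn_sub y (hS.average hδ y))] with t h1 h2 h3 ht
  change ((δ : ℂ)⁻¹ • (y - hS.average hδ y) : Space p β κ) t = _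
  rw [h2 ht, Pi.smul_apply, h3 ht, Pi.sub_apply, h1 ht, Complex.ofReal_inv, smul_eq_mul]

theorem isBoundedInverse_shift_JMinus (hβ : 0 < β) (hp : p ≠ ⊤) (hσ : κ * (-1) ≤ 0) {δ : ℝ}
    (hδ : 0 < δ) : IsBoundedInverse (shift (JMinus p β κ) δ)
      ((isContractionSemigroup_translationSemigroup hp hσ).yosida hδ) := by
  refine IsContractionSemigroup.isBoundedInverse_yosida _ hδ (fun x f hxf => ?_) fun y => ?_
  · rw [JMinus_graph] at hxf
    exact average_of_hasJMinus hp hσ hδ hxf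
  · rw [JMinus_graph]
    exact hasJMinus_yosida hβ hp hσ hδ y

end

/-! ### Exponentially decaying kernels -/

section

variable {ε : ℝ} {k : ℝ → ℝ}

/-- The elementary inequality `|k| e^{ρ s} ≤ k² e^{ε s} + e^{(2 ρ - ε) s}` makes `k e^{ρ s}`
integrable for `ρ < ε / 2`. -/
theorem MemWeighted.integrableOn_Ioi (hk : MemWeighted ε k) {ρ : ℝ} (hρ : ρ < ε / 2) :
    IntegrableOn (fun s => k s * Real.exp (ρ * s)) (Ioi 0) := by
  have hexp := integrableOn_exp_mul_Ioi (a := 2 * ρ - ε) (by linarith) 0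
  refine Integrable.mono' (hk.2.integrableOn.add hexp)
    (hk.1.restrict.mul (Continuous.aestronglyMeasurable (by fun_prop))) ?_
  filter_upwards [self_mem_ae_restrict measurableSet_Ioi] with s hs
  rw [norm_mul, Real.norm_of_nonneg (Real.exp_pos _).le, Pi.add_apply, Real.norm_eq_abs,
    abs_of_pos (show (0 : ℝ) < s from hs)]
  set u := Real.exp (ε / 2 * s) with hu
  set v := Real.exp ((ρ - ε / 2) * s) with hv
  have h1 : Real.exp (ρ * s) = u * v := by
    rw [hu, hv, ← Real.exp_add]
    ring_nf
  have h2 : Real.exp (ε * s) = u ^ 2 := by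
    rw [hu, ← Real.exp_nat_mul]
    ring_nf
  have h3 : Real.exp ((2 * ρ - ε) * s) = v ^ 2 := by
    rw [hv, ← Real.exp_nat_mul]
    ring_nf
  rw [h1, h2, h3, ← sq_abs (k s)]
  nlinarith [sq_nonneg (|k s| * u - v), sq_nonneg (|k s| * u), sq_nonneg v]

theorem MemWeightedPlus.hat_eq (hk : MemWeightedPlus ε k) (z : ℂ) :
    hat k z = ∫ s in Ioi (0 : ℝ), Complex.exp (Complex.I * z * s) * (k s : ℂ) := by
  refine (setIntegral_eq_integral_of_ae_compl_eq_zero ?_).symm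
  filter_upwards [hk.2, Measure.ae_ne volume (0 : ℝ)] with s h1 h2 hs
  rw [h1 (lt_of_le_of_ne (not_lt.1 hs) h2), Complex.ofReal_zero, mul_zero]

theorem MemWeightedMinus.comp_neg (hk : MemWeightedMinus ε k) :
    MemWeightedPlus ε fun s => k (-s) := by
  have hmp := Measure.measurePreserving_neg (volume : Measure ℝ)
  refine ⟨⟨hk.1.1.comp_measurePreserving hmp, ?_⟩, ?_⟩
  · simpa [Function.comp_def] using hmp.integrable_comp_of_integrable hk.1.2
  · filter_upwards [hmp.quasiMeasurePreserving.ae hk.2] with s hs h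
    exact hs (neg_pos.2 h)

/-- Reflection reduces the kernels on `(-∞, 0)` to kernels on `(0, ∞)`. -/
theorem hat_eq_hat_comp_neg (k : ℝ → ℝ) (z : ℂ) : hat k z = hat (fun s => k (-s)) (-z) := by
  rw [hat, ← integral_neg_eq_self, hat]
  simp

end

end IndefConv

end

theorem theorem4p1 (β : EReal) (hβ : 0 < β) (p : ENNReal) [Fact (1 ≤ p)] (hp : p ≠ ⊤)
    (c : ℝ) (hc : 0 ≤ c) (ε : ℝ) (hε : 0 < ε) (kPlus kMinus : ℝ → ℝ)
    (hkPlus : IndefConv.MemWeightedPlus ε kPlus)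
    (hkMinus : IndefConv.MemWeightedMinus ε kMinus) :
    (∃ Q : IndefConv.Space p β (-c) →L[ℂ] IndefConv.Space p β (-c),
      IndefConv.IsValueAtInverse {z : ℂ | -(ε / 2) < z.im} (IndefConv.hat kPlus)
        Complex.I (IndefConv.JPlus p β (-c)) Q ∧
      ∀ g : IndefConv.Space p β (-c), ∀ᵐ t : ℝ, t ∈ IndefConv.interval β →
        IntegrableOn (fun y : ℝ => (kPlus (t - y) : ℂ) * g y) (Set.Ioo 0 t) volume ∧
        ∫ y in Set.Ioo 0 t, (kPlus (t - y) : ℂ) * g y = Q g t) ∧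
    (∃ Q : IndefConv.Space p β c →L[ℂ] IndefConv.Space p β c,
      IndefConv.IsValueAtInverse {z : ℂ | z.im < ε / 2} (IndefConv.hat kMinus)
        (-Complex.I) (IndefConv.JMinus p β c) Q ∧
      ∀ g : IndefConv.Space p β c, ∀ᵐ t : ℝ, t ∈ IndefConv.interval β →
        IntegrableOn (fun y : ℝ => (kMinus (t - y) : ℂ) * g y)
          {y : ℝ | t < y ∧ (y : EReal) < β} volume ∧
        ∫ y in {y : ℝ | t < y ∧ (y : EReal) < β}, (kMinus (t - y) : ℂ) * g y = Q g t) := by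
  have hη : 0 < ε / 2 := half_pos hε
  have hint0 : ∀ k : ℝ → ℝ, IndefConv.MemWeighted ε k → IntegrableOn k (Ioi 0) := fun k hk => by
    simpa using hk.integrableOn_Ioi hη
  refine ⟨?_, ?_⟩
  · have hσ : -c * 1 ≤ 0 := by linarith
    have hU : {z : ℂ | -(ε / 2) < z.im} = {z : ℂ | (Complex.I * z).re < ε / 2} := by
      ext z
      simp [neg_lt]
    refine ⟨(IndefConv.isContractionSemigroup_translationSemigroup hp hσ).laplace
      (hint0 _ hkPlus.1), ?_, fun g => IndefConv.ae_laplace_right hp hσ (hint0 _ hkPlus.1) g⟩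
    rw [hU]
    exact IndefConv.IsContractionSemigroup.isValueAtInverse_laplace _
      (fun δ hδ => IndefConv.isBoundedInverse_shift_JPlus hp hσ hδ) hη
      (fun ρ hρ => hkPlus.1.integrableOn_Ioi hρ) _ Complex.I_mul_I hkPlus.hat_eq
  · have hσ : c * (-1) ≤ 0 := by linarith
    have hk := hkMinus.comp_neg
    have hU : {z : ℂ | z.im < ε / 2} = {z : ℂ | (-Complex.I * z).re < ε / 2} := by
      ext z
      simp
    refine ⟨(IndefConv.isContractionSemigroup_translationSemigroup hp hσ).laplace
      (hint0 _ hk.1), ?_, fun g => IndefConv.ae_laplace_left hp hσ (hint0 _ hk.1) g⟩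
    rw [hU]
    refine IndefConv.IsContractionSemigroup.isValueAtInverse_laplace _
      (fun δ hδ => IndefConv.isBoundedInverse_shift_JMinus hβ hp hσ hδ) hη
      (fun ρ hρ => hk.1.integrableOn_Ioi hρ) _ (by simp) fun z => ?_
    rw [IndefConv.hat_eq_hat_comp_neg, hk.hat_eq]
    simp only [mul_neg, neg_mul]
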